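/- Consider $m\le n$ cars and a one-way street with spots $1,\dots,n$. The cars enter one after the other; car $i$ drives to its preferred spot $\pi_i\in\{1,\dots,n\}$ and parks there if it is free, and otherwise parks in the first free spot after it, if there is one. Let $\mathrm{PF}(m,n)$ be the set of (generalized) parking functions, i.e. of the $\pi=(\pi_1,\dots,\pi_m)\in\{1,\dots,n\}^m$ for which all cars park, and let $\tau(\pi)=(\tau_1,\dots,\tau_m)$ be the parking outcome of $\pi\in\mathrm{PF}(m,n)$: the $i$th car parks in spot $\tau_i$. Theorem. Fix $0<c<1$. Let $\pi$ be chosen uniformly at random from $\mathrm{PF}(m,n)$, where $m=cn$ and $m,n\to\infty$ (through those integers $n$ for which $cn$ is an integer). (1) For all integers $l\ge 1$ and $p_1,\dots,p_l\ge 1$, $$\mathbb{E}\Big(\prod_{i=1}^l \tau_i^{p_i}\Big)=\frac{n^{\sum_{i=1}^l p_i}}{\prod_{i=1}^l (p_i+1)}\left(1+\frac1n\left(\frac{\sum_{i=1}^l p_i+l}{2}-\frac{c\sum_{i=1}^l p_i}{1-c}\right)+O\!\left(\frac1{n^2}\right)\right),$$ where the constant in the error term may depend on $c$, $l$ and $p_1,\dots,p_l$.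 (2) For every fixed index $i\ge 1$ and every integer $p\ge 1$, $$\mathbb{E}(\tau_i^{p})=\frac{n^{p}}{p+1}\left(1+\frac1n\left(\frac{p+1}{2}-\frac{cp}{1-c}\right)+O\!\left(\frac1{n^2}\right)\right),$$ and the same expansion holds for $\mathbb{E}(\pi_i^{p})$; the constants in the error terms may depend on $c$, $i$ and $p$. -/

import Mathlib

open Finset
open scoped BigOperators

/-- The parking outcome of a list of preferences `π` on a one-way street whose spots are numbered
by natural numbers: the cars enter in the order `0, 1, …, m - 1`, and car `i` parks in the first
spot `s ≥ π i` that is not occupied by an earlier car. The street has no last spot here; the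
restriction to a car park with `n` spots is made in `IsParkingFunction`. -/
noncomputable def parkingOutcome {m : ℕ} (π : Fin m → ℕ) (i : Fin m) : ℕ :=
  sInf {s : ℕ | π i ≤ s ∧ ∀ j : Fin m, ∀ _ : j < i, parkingOutcome π j ≠ s}
termination_by i

/-- A list of preferences `π = (π 0, …, π (m - 1))` with values in `{1, …, n}` is a
(generalized) parking function for `m` cars and `n` spots if every car parks in one of the
spots `1, …, n`. (A car that finds no free spot in `{1, …, n}` is one that passes spot `n` on
the unbounded street.) -/
def IsParkingFunction (m n : ℕ) (π : Fin m → ℕ) : Prop :=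
  (∀ i, 1 ≤ π i ∧ π i ≤ n) ∧ ∀ i, parkingOutcome π i ≤ n

open Classical in
/-- The finite set `PF(m, n)` of parking functions with `m` cars and `n` spots. -/
noncomputable def PF (m n : ℕ) : Finset (Fin m → ℕ) :=
  {π ∈ Fintype.piFinset (fun _ : Fin m => Finset.Icc 1 n) | IsParkingFunction m n π}

theorem mem_PF {m n : ℕ} {π : Fin m → ℕ} : π ∈ PF m n ↔ IsParkingFunction m n π := by
  classical
  simp only [PF, Finset.mem_filter, Fintype.mem_piFinset, Finset.mem_Icc,
    and_iff_right_iff_imp]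
  exact fun h => h.1

/-- The infimum in `parkingOutcome` is attained. -/
theorem parkingOutcome_isLeast {m : ℕ} (π : Fin m → ℕ) (i : Fin m) :
    IsLeast {s : ℕ | π i ≤ s ∧ ∀ j : Fin m, j < i → parkingOutcome π j ≠ s}
      (parkingOutcome π i) := by
  have hne : {s : ℕ | π i ≤ s ∧ ∀ j : Fin m, j < i → parkingOutcome π j ≠ s}.Nonempty := by
    refine ⟨π i + ∑ j, (parkingOutcome π j + 1), Nat.le_add_right _ _, fun j _ h => ?_⟩
    have h1 := Finset.single_le_sum (f := fun j => parkingOutcome π j + 1)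
      (fun j _ => Nat.zero_le _) (Finset.mem_univ j)
    omega
  have h : parkingOutcome π i
      = sInf {s : ℕ | π i ≤ s ∧ ∀ j : Fin m, j < i → parkingOutcome π j ≠ s} := by
    rw [parkingOutcome]
  rw [h]
  exact ⟨Nat.sInf_mem hne, fun s hs => Nat.sInf_le hs⟩

/-- Being a parking function and the parking outcome, described inside the car park `{1, …, n}`. -/
theorem isParkingFunction_and_outcome_iff {m n : ℕ} (π τ : Fin m → ℕ)
    (hπ : ∀ i, 1 ≤ π i ∧ π i ≤ n) :
    (IsParkingFunction m n π ∧ τ = parkingOutcome π) ↔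
      ∀ i, IsLeast {s : ℕ | (1 ≤ s ∧ s ≤ n) ∧ π i ≤ s ∧ ∀ j, j < i → τ j ≠ s} (τ i) := by
  constructor
  · rintro ⟨h, rfl⟩ i
    obtain ⟨h1, h2⟩ := parkingOutcome_isLeast π i
    exact ⟨⟨⟨(hπ i).1.trans h1.1, h.2 i⟩, h1⟩, fun s hs => h2 hs.2⟩
  · intro h
    have key : ∀ k : ℕ, ∀ i : Fin m, i.val = k → τ i = parkingOutcome π i := by
      intro k
      induction k using Nat.strong_induction_on with
      | _ k ih =>
        intro i hi
        obtain ⟨h1, h2⟩ := h i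
        obtain ⟨g1, g2⟩ := parkingOutcome_isLeast π i
        have hj : ∀ j, j < i → τ j = parkingOutcome π j := fun j hj =>
          ih j.val (by rw [← hi]; exact hj) j rfl
        have hle : parkingOutcome π i ≤ τ i :=
          g2 ⟨h1.2.1, fun j hji => by rw [← hj j hji]; exact h1.2.2 j hji⟩
        refine le_antisymm (h2 ⟨⟨(hπ i).1.trans g1.1, hle.trans h1.1.2⟩, g1.1, ?_⟩) hle
        exact fun j hji => by rw [hj j hji]; exact g1.2 j hji
    have e : τ = parkingOutcome π := funext fun i => key i.val i rfl
    exact ⟨⟨hπ, fun i => by rw [← e]; exact (h i).1.1.2⟩, e⟩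

/-!
Let `N t π` be the number of cars with a preference beyond spot `t`. A list of preferences is a
parking function if and only if `N t π + t ≤ n` for all `t ≤ n` (`isParkingFunction_iff`); this does
not depend on the order of the cars. Removing the first spot gives a recursion for the number of
parking functions, solved by `(n + 1 - m) (n + 1) ^ (m - 1)` (`card_PF`). Hence for `m ≤ c n`
parking functions make up at least the fraction `1 - c` of all lists of preferences, and events
that are rare for independent uniform preferences are rare for parking functions as well.

Take the `l` cars under study out and let `y` be the parking function of the others. If `s` is the
last spot left free by `y`, then the preferences of the `l` cars range over `{1, …, s} ^ l`, except
for some combinations in which two of them fall near the end of the street, in the region that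
holds at most `l` free spots (`le_slackSpot_of_append_mem_PF`, `append_mem_PF_of_le`). The length
`n - s` and the length of that end region have bounded second moments, by a Chernoff bound
(`sum_sq_slackSpot_le`), so the exceptions contribute only at relative order `1 / n ^ 2`, and on
the box the sum of a monomial is a product of power sums `∑ j ≤ s, j ^ p`, expanded by Faulhaber's
formula. Averaging over `y` only needs the mean of `n - s`. As `y` has exactly `s` extensions by one
car, the count gives this mean: it is `m' / (n - m' + 1)` with `m' = m - l`
(`sum_sub_slackSpot`), that is `c / (1 - c) + O(1 / n)`. Dividing by the same expansion with all
exponents `0` yields the mixed moments of the preferences (`abs_expect_preference_sub_le`).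

The outcomes of the first `l` cars equal their preferences unless two of these preferences agree,
which has probability `O(1 / n)`, and even then they differ by at most `l`; so the moments of
outcomes and of preferences agree to the required order
(`abs_expect_outcome_sub_expect_preference_le`).
-/

/-! ### Parking functions as a condition on tail counts -/

theorem le_parkingOutcome {m : ℕ} (π : Fin m → ℕ) (i : Fin m) : π i ≤ parkingOutcome π i :=
  (parkingOutcome_isLeast π i).1.1

theorem parkingOutcome_injective {m : ℕ} (π : Fin m → ℕ) :
    Function.Injective (parkingOutcome π) := by
  intro i j h
  rcases lt_trichotomy i j with hij | hij | hij
  · exact absurd h ((parkingOutcome_isLeast π j).1.2 i hij)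
  · exact hij
  · exact absurd h.symm ((parkingOutcome_isLeast π i).1.2 j hij)

/-- Every spot that car `i` passes is occupied by an earlier car. -/
theorem exists_parkingOutcome_eq {m : ℕ} (π : Fin m → ℕ) (i : Fin m) {s : ℕ}
    (h1 : π i ≤ s) (h2 : s < parkingOutcome π i) : ∃ j < i, parkingOutcome π j = s := by
  by_contra! h
  exact absurd ((parkingOutcome_isLeast π i).2 ⟨h1, h⟩) (by omega)

/-- All cars park in `{1, …, n}` if and only if, for every `t ≤ n`, at most `n - t` cars prefer
one of the `n - t` spots beyond `t`. In particular the order of the cars is irrelevant. -/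
theorem isParkingFunction_iff {m n : ℕ} {π : Fin m → ℕ} :
    IsParkingFunction m n π ↔
      (∀ i, 1 ≤ π i ∧ π i ≤ n) ∧ ∀ t ≤ n, #{i | t < π i} + t ≤ n := by
  constructor
  · rintro ⟨h, h'⟩
    refine ⟨h, fun t ht => ?_⟩
    have : #{i | t < π i} ≤ #(Ioc t n) := by
      refine card_le_card_of_injOn (parkingOutcome π) (fun i hi => ?_)
        (parkingOutcome_injective π).injOn
      have hi : t < π i := by simpa using hi
      simp only [coe_Ioc, Set.mem_Ioc]
      exact ⟨hi.trans_le (le_parkingOutcome π i), h' i⟩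
    rw [Nat.card_Ioc] at this
    omega
  · rintro ⟨h, h'⟩
    refine ⟨h, fun i => ?_⟩
    by_contra! hi
    -- `t` is the last spot below `π i` that is free when car `i` arrives, or `0`.
    obtain ⟨t, ht, hmax⟩ : ∃ t, (t < π i ∧ ∀ j < i, parkingOutcome π j ≠ t) ∧
        ∀ s, t < s → s < π i → ∃ j < i, parkingOutcome π j = s := by
      classical
      have h0 : (0 < π i ∧ ∀ j < i, parkingOutcome π j ≠ 0) :=
        ⟨(h i).1, fun j _ => by have := le_parkingOutcome π j; have := (h j).1; omega⟩
      let P : ℕ → Prop := fun t => t < π i ∧ ∀ j < i, parkingOutcome π j ≠ t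
      refine ⟨Nat.findGreatest P (π i), Nat.findGreatest_spec (P := P) (Nat.zero_le _) h0,
        fun s hs hs' => ?_⟩
      have := Nat.findGreatest_is_greatest (P := P) hs hs'.le
      by_contra! hc
      exact this ⟨hs', hc⟩
    have hocc : ∀ s ∈ Ioc t n, ∃ j < i, parkingOutcome π j = s := fun s hs => by
      rw [mem_Ioc] at hs
      by_cases hsi : s < π i
      · exact hmax s hs.1 hsi
      · exact exists_parkingOutcome_eq π i (by omega) (by omega)
    have hsub : Ioc t n ⊆ image (parkingOutcome π) (({j | t < π j} : Finset (Fin m)).erase i) := by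
      intro s hs
      obtain ⟨j, hj, hjs⟩ := hocc s hs
      refine mem_image.2 ⟨j, mem_erase.2 ⟨hj.ne, by
        simp only [mem_filter, mem_univ, true_and]
        by_contra! hle
        obtain ⟨k, hk, hkt⟩ := exists_parkingOutcome_eq π j hle
          (by rw [hjs]; exact (mem_Ioc.1 hs).1)
        exact ht.2 k (hk.trans hj) hkt⟩, hjs⟩
    have hc := (card_le_card hsub).trans card_image_le
    rw [card_erase_of_mem (by simpa using ht.1), Nat.card_Ioc] at hc
    have hpos : 0 < #{j | t < π j} := card_pos.2 ⟨i, by simpa using ht.1⟩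
    have := h' t (by have := (h i).2; omega)
    have := (h i).2
    omega

/-! ### The number of parking functions -/

/-- Parking functions on the cars of a finite set `s` for the spots `1, …, n`, extended by the
value `0` to the cars outside of `s`. -/
def supportedPF {ι : Type*} [Fintype ι] [DecidableEq ι] (s : Finset ι) (n : ℕ) :
    Finset (ι → ℕ) :=
  {x ∈ Fintype.piFinset fun i => if i ∈ s then Icc 1 n else {0} |
    ∀ t ≤ n, #{i | t < x i} + t ≤ n}

theorem mem_supportedPF {ι : Type*} [Fintype ι] [DecidableEq ι] {s : Finset ι} {n : ℕ}
    {x : ι → ℕ} : x ∈ supportedPF s n ↔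
      ((∀ i ∈ s, 1 ≤ x i ∧ x i ≤ n) ∧ ∀ i ∉ s, x i = 0) ∧
        ∀ t ≤ n, #{i | t < x i} + t ≤ n := by
  simp only [supportedPF, mem_filter, Fintype.mem_piFinset]
  refine and_congr_left fun _ => ⟨fun h => ⟨fun i hi => ?_, fun i hi => ?_⟩, fun h i => ?_⟩
  · simpa [hi] using h i
  · simpa [hi] using h i
  · by_cases hi : i ∈ s
    · simpa [hi] using h.1 i hi
    · simpa [hi] using h.2 i hi

theorem PF_eq_supportedPF (m n : ℕ) : PF m n = supportedPF univ n := by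
  ext π
  simp [mem_PF, isParkingFunction_iff, mem_supportedPF]

/-- Removing the first spot: subtracting `1` from all preferences identifies the parking functions
on `s` for `n + 1` spots with the parking functions for `n` spots on the subsets of `s` (the cars
that do not prefer the first spot). -/
theorem card_supportedPF_succ {ι : Type*} [Fintype ι] [DecidableEq ι] {s : Finset ι} {n : ℕ}
    (hs : #s ≤ n + 1) :
    #(supportedPF s (n + 1)) = ∑ J ∈ s.powerset, #(supportedPF J n) := by
  rw [card_eq_sum_card_fiberwise (f := fun x : ι → ℕ => ({i | 1 < x i} : Finset ι))
    (t := s.powerset)]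
  · refine sum_congr rfl fun J hJ => ?_
    rw [mem_powerset] at hJ
    refine card_nbij' (fun x i => x i - 1) (fun y i => if i ∈ s then y i + 1 else 0) ?_ ?_ ?_ ?_
    · intro x hx
      simp only [coe_filter, Set.mem_ofPred_eq, mem_supportedPF] at hx
      obtain ⟨⟨⟨h1, h2⟩, h3⟩, rfl⟩ := hx
      simp only [mem_coe, mem_supportedPF, mem_filter, mem_univ, true_and, not_lt]
      refine ⟨⟨fun i hi => ?_, fun i hi => by omega⟩, fun t ht => ?_⟩
      · have := h1 i (by by_contra hc; have := h2 i hc; omega)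
        omega
      · have h := h3 (t + 1) (by omega)
        simp only [Nat.lt_sub_iff_add_lt]
        omega
    · intro y hy
      simp only [mem_coe, mem_supportedPF] at hy
      obtain ⟨⟨h1, h2⟩, h3⟩ := hy
      simp only [coe_filter, Set.mem_ofPred_eq, mem_supportedPF]
      refine ⟨⟨⟨fun i hi => ?_, fun i hi => by simp [hi]⟩, fun t ht => ?_⟩, ?_⟩
      · simp only [hi, if_true]
        by_cases hiJ : i ∈ J
        · have := h1 i hiJ; omega
        · have := h2 i hiJ; omega
      · rcases t with _ | t
        · have : #{i | 0 < if i ∈ s then y i + 1 else 0} ≤ #s := card_le_card fun i hi => by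
            by_contra hc
            simp [hc] at hi
          omega
        · have h := h3 t (by omega)
          have : #{i | t + 1 < if i ∈ s then y i + 1 else 0} ≤ #{i | t < y i} :=
            card_le_card fun i hi => by
              simp only [mem_filter, mem_univ, true_and] at hi ⊢
              split_ifs at hi <;> omega
          omega
      · ext i
        simp only [mem_filter, mem_univ, true_and]
        by_cases hiJ : i ∈ J
        · have := h1 i hiJ
          simp only [hJ hiJ, if_true, hiJ, iff_true]; omega
        · have := h2 i hiJ
          simp only [hiJ, iff_false, this]; split_ifs <;> omega
    · intro x hx
      simp only [coe_filter, Set.mem_ofPred_eq, mem_supportedPF] at hx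
      funext i
      by_cases hi : i ∈ s
      · have := hx.1.1.1 i hi
        simp only [hi, if_true]; omega
      · simp [hi, hx.1.1.2 i hi]
    · intro y hy
      simp only [mem_coe, mem_supportedPF] at hy
      funext i
      by_cases hi : i ∈ s
      · simp [hi]
      · simp [hi, hy.1.2 i (fun h => hi (hJ h))]
  · intro x hx
    simp only [mem_coe, mem_supportedPF] at hx
    simp only [coe_powerset, Set.mem_preimage, Set.mem_powerset_iff]
    intro i hi
    have hi : 1 < x i := by simpa using hi
    by_contra hc
    have := hx.1.2 i hc
    omega

theorem sum_powerset_sub_card_mul_pow {ι : Type*} [DecidableEq ι] (s : Finset ι) (a : ℝ) :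
    (a + 1) * ∑ J ∈ s.powerset, (a - #J) * a ^ #J = a * (a + 1 - #s) * (a + 1) ^ #s := by
  induction s using Finset.induction_on with
  | empty => simp; ring
  | insert i s hi ih =>
    have h1 : ∀ J ∈ s.powerset, (a - #(insert i J)) * a ^ #(insert i J)
        = a * ((a - #J) * a ^ #J) - a * a ^ #J := fun J hJ => by
      rw [card_insert_of_notMem fun h => hi (mem_powerset.1 hJ h)]
      push_cast; ring
    have h2 : ∑ J ∈ s.powerset, a ^ #J = (a + 1) ^ #s := by
      simpa using Finset.sum_pow_mul_eq_add_pow a 1 s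
    rw [sum_powerset_insert hi, sum_congr rfl h1, sum_sub_distrib, ← mul_sum, ← mul_sum, h2,
      card_insert_of_notMem hi]
    push_cast
    linear_combination (1 + a) * ih

theorem card_supportedPF {ι : Type*} [Fintype ι] [DecidableEq ι] (n : ℕ) (s : Finset ι)
    (hs : #s ≤ n + 1) :
    ((n : ℝ) + 1) * #(supportedPF s n) = (n + 1 - #s) * ((n : ℝ) + 1) ^ #s := by
  -- With one car more than spots there are no parking functions.
  have hempty : ∀ (n : ℕ) (s : Finset ι), #s = n + 1 → #(supportedPF s n) = 0 := fun n s hs => by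
    rw [card_eq_zero, eq_empty_iff_forall_notMem]
    intro x hx
    rw [mem_supportedPF] at hx
    have h := hx.2 0 (Nat.zero_le _)
    have : #s ≤ #{i | 0 < x i} := card_le_card fun i hi => by
      simpa using Nat.lt_of_succ_le (hx.1.1 i hi).1
    omega
  induction n generalizing s with
  | zero =>
    rcases Nat.lt_or_ge #s 1 with h | h
    · obtain rfl : s = ∅ := card_eq_zero.1 (by omega)
      have : supportedPF (∅ : Finset ι) 0 = {fun _ => 0} := by
        ext x
        simp only [mem_supportedPF, mem_singleton]
        constructor
        · exact fun h => funext fun i => h.1.2 i (notMem_empty i)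
        · rintro rfl
          simp
      simp [this]
    · have h1 : #s = 1 := by omega
      simp [hempty 0 s (by omega), h1]
  | succ n ih =>
    rcases Nat.lt_or_ge #s (n + 2) with h | h
    · have hn : (n : ℝ) + 1 ≠ 0 := by positivity
      have h1 := sum_powerset_sub_card_mul_pow s ((n : ℝ) + 1)
      have h2 : ∑ J ∈ s.powerset, ((n : ℝ) + 1 - #J) * ((n : ℝ) + 1) ^ #J
          = ((n : ℝ) + 1) * #(supportedPF s (n + 1)) := by
        rw [card_supportedPF_succ (by omega), Nat.cast_sum, mul_sum]
        refine sum_congr rfl fun J hJ => (ih J ?_).symm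
        have := card_le_card (mem_powerset.1 hJ)
        omega
      rw [h2] at h1
      push_cast
      apply mul_left_cancel₀ hn
      linear_combination h1
    · have h1 : #s = n + 2 := by omega
      rw [hempty (n + 1) s (by omega), h1]
      push_cast
      ring

/-- The number of parking functions is `(n + 1 - m) (n + 1) ^ (m - 1)`. -/
theorem card_PF {m n : ℕ} (h : m ≤ n + 1) :
    ((n : ℝ) + 1) * #(PF m n) = (n + 1 - m) * ((n : ℝ) + 1) ^ m := by
  rw [PF_eq_supportedPF]
  simpa using card_supportedPF n (univ : Finset (Fin m)) (by simpa using h)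

/-- If the street is filled to at most the fraction `c`, then at least the fraction `1 - c` of all
lists of preferences are parking functions. -/
theorem le_card_PF {c : ℝ} (hc0 : 0 < c) (hc1 : c < 1) {m n : ℕ} (h : (m : ℝ) ≤ c * n) :
    (1 - c) * (n : ℝ) ^ m ≤ #(PF m n) := by
  have hn : (0 : ℝ) ≤ n := n.cast_nonneg
  have hmn : m ≤ n + 1 := by
    have : (m : ℝ) ≤ (n + 1 : ℕ) := by push_cast; nlinarith
    exact_mod_cast this
  have h1 := card_PF hmn
  have h2 : (1 - c) * ((n : ℝ) + 1) ≤ n + 1 - m := by nlinarith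
  have h3 : (n : ℝ) ^ m ≤ ((n : ℝ) + 1) ^ m := by gcongr; linarith
  refine le_of_mul_le_mul_left (a := (n : ℝ) + 1) ?_ (by positivity)
  rw [h1]
  calc ((n : ℝ) + 1) * ((1 - c) * (n : ℝ) ^ m) = (1 - c) * ((n : ℝ) + 1) * (n : ℝ) ^ m := by ring
    _ ≤ (n + 1 - m) * ((n : ℝ) + 1) ^ m := by
      refine mul_le_mul h2 h3 (by positivity) (le_trans ?_ h2)
      exact mul_nonneg (by linarith) (by positivity)

/-! ### Adding cars to a parking function -/

/-- The leftmost spot `t` such that at least `n - t - r` of the preferences `y` lie beyond `t`.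
For a parking function `y` and `r = 0`, this is the last spot that stays free (or `0` if there is
none), and `{t + 1, …, n}` is then the final block of occupied spots. In general, at most `r` spots
beyond `t` stay free. -/
noncomputable def slackSpot {ι : Type*} [Fintype ι] (n r : ℕ) (y : ι → ℕ) : ℕ :=
  sInf {t | n ≤ #{i | t < y i} + t + r}

theorem le_of_slackSpot {ι : Type*} [Fintype ι] (n r : ℕ) (y : ι → ℕ) :
    n ≤ #{i | slackSpot n r y < y i} + slackSpot n r y + r :=
  Nat.sInf_mem (s := {t | n ≤ #{i | t < y i} + t + r})
    ⟨n, by simp only [Set.mem_ofPred_eq]; omega⟩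

theorem slackSpot_le {ι : Type*} [Fintype ι] (n r : ℕ) (y : ι → ℕ) : slackSpot n r y ≤ n :=
  Nat.sInf_le (by simp only [Set.mem_ofPred_eq]; omega)

theorem lt_of_lt_slackSpot {ι : Type*} [Fintype ι] {n r t : ℕ} {y : ι → ℕ}
    (h : t < slackSpot n r y) : #{i | t < y i} + t + r < n := by
  have := Nat.notMem_of_lt_sInf h
  simpa using this

theorem slackSpot_le_slackSpot_zero {ι : Type*} [Fintype ι] (n r : ℕ) (y : ι → ℕ) :
    slackSpot n r y ≤ slackSpot n 0 y := by
  by_contra! h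
  have h1 := lt_of_lt_slackSpot h
  have h2 := le_of_slackSpot n 0 y
  omega

theorem card_lt_append {l m : ℕ} (x : Fin l → ℕ) (y : Fin m → ℕ) (t : ℕ) :
    #{i | t < Fin.append x y i} = #{i | t < x i} + #{i | t < y i} := by
  simp only [card_filter, Fin.sum_univ_add, Fin.append_left, Fin.append_right]

theorem append_mem_PF_iff {l m n : ℕ} {x : Fin l → ℕ} {y : Fin m → ℕ} (hy : y ∈ PF m n) :
    Fin.append x y ∈ PF (l + m) n ↔
      (∀ i, 1 ≤ x i ∧ x i ≤ n) ∧ ∀ t ≤ n, #{i | t < x i} + #{i | t < y i} + t ≤ n := by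
  rw [mem_PF, isParkingFunction_iff] at *
  simp only [card_lt_append]
  refine and_congr_left fun _ => ⟨fun h i => ?_, fun h i => ?_⟩
  · simpa using h (Fin.castAdd m i)
  · refine Fin.addCases (fun i => ?_) (fun i => ?_) i
    · simpa using h i
    · simpa using hy.1 i

theorem right_mem_PF_of_append {l m n : ℕ} {x : Fin l → ℕ} {y : Fin m → ℕ}
    (h : Fin.append x y ∈ PF (l + m) n) : y ∈ PF m n := by
  rw [mem_PF, isParkingFunction_iff] at *
  refine ⟨fun i => by simpa using h.1 (Fin.natAdd l i), fun t ht => ?_⟩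
  have := h.2 t ht
  rw [card_lt_append] at this
  omega

/-- No car fits beyond the last free spot. -/
theorem le_slackSpot_of_append_mem_PF {l m n : ℕ} {x : Fin l → ℕ} {y : Fin m → ℕ}
    (h : Fin.append x y ∈ PF (l + m) n) (i : Fin l) : x i ≤ slackSpot n 0 y := by
  have hy := right_mem_PF_of_append h
  rw [append_mem_PF_iff hy] at h
  by_contra! hi
  have h1 := h.2 _ (slackSpot_le n 0 y)
  have h2 := le_of_slackSpot n 0 y
  have h3 : 0 < #{i | slackSpot n 0 y < x i} := card_pos.2 ⟨i, by simpa using hi⟩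
  omega

/-- If the `l` additional cars prefer spots up to the last free one and at most one of them prefers
a spot from the region near the end of the street that has at most `l` free spots, then all of
them can park. -/
theorem append_mem_PF_of_le {l m n : ℕ} {x : Fin l → ℕ} {y : Fin m → ℕ} (hy : y ∈ PF m n)
    (h1 : ∀ i, 1 ≤ x i ∧ x i ≤ slackSpot n 0 y)
    (h2 : ∀ i j, slackSpot n l y < x i → slackSpot n l y < x j → i = j) :
    Fin.append x y ∈ PF (l + m) n := by
  rw [append_mem_PF_iff hy]
  refine ⟨fun i => ⟨(h1 i).1, (h1 i).2.trans (slackSpot_le n 0 y)⟩, fun t ht => ?_⟩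
  have hy := (isParkingFunction_iff.1 (mem_PF.1 hy)).2 t ht
  rcases le_or_gt (slackSpot n 0 y) t with h | h
  · have : #{i | t < x i} = 0 := by
      rw [card_eq_zero, filter_eq_empty_iff]
      exact fun i _ => not_lt.2 ((h1 i).2.trans h)
    omega
  · have h0 := lt_of_lt_slackSpot h
    rcases le_or_gt (slackSpot n l y) t with h' | h'
    · have : #{i | t < x i} ≤ 1 := card_le_one.2 fun i hi j hj => by
        simp only [mem_filter, mem_univ, true_and] at hi hj
        exact h2 i j (h'.trans_lt hi) (h'.trans_lt hj)
      omega
    · have h3 := lt_of_lt_slackSpot h'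
      have : #{i | t < x i} ≤ l := by simpa using card_le_univ ({i | t < x i} : Finset (Fin l))
      omega

theorem sum_PF_add {l m n : ℕ} (g : (Fin (l + m) → ℕ) → ℝ) :
    ∑ π ∈ PF (l + m) n, g π = ∑ y ∈ PF m n,
      ∑ x ∈ Fintype.piFinset (fun _ : Fin l => Icc 1 (slackSpot n 0 y)) with
        Fin.append x y ∈ PF (l + m) n, g (Fin.append x y) := by
  rw [sum_sigma']
  symm
  refine sum_nbij' (fun a => Fin.append a.2 a.1)
    (fun π => ⟨fun i => π (Fin.natAdd l i), fun i => π (Fin.castAdd m i)⟩) ?_ ?_ ?_ ?_ ?_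
  · intro a ha
    simp only [mem_sigma, mem_filter] at ha
    exact ha.2.2
  · intro π hπ
    have e : Fin.append (fun i => π (Fin.castAdd m i)) (fun i => π (Fin.natAdd l i)) = π :=
      Fin.append_castAdd_natAdd
    rw [← e] at hπ
    simp only [mem_sigma, mem_filter, Fintype.mem_piFinset, mem_Icc]
    exact ⟨right_mem_PF_of_append hπ, fun i => ⟨by
      simpa using (((append_mem_PF_iff (right_mem_PF_of_append hπ)).1 hπ).1 i).1,
      le_slackSpot_of_append_mem_PF hπ i⟩, hπ⟩
  · intro a _
    simp
  · intro π _
    exact Fin.append_castAdd_natAdd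
  · intro a _
    rfl

/-- A parking function can be extended by one car in exactly as many ways as there are spots up to
the last free one. -/
theorem card_PF_succ (m n : ℕ) : (#(PF (1 + m) n) : ℝ) = ∑ y ∈ PF m n, (slackSpot n 0 y : ℝ) := by
  have h := sum_PF_add (l := 1) (m := m) (n := n) fun _ => 1
  rw [sum_const, nsmul_one] at h
  rw [h]
  refine sum_congr rfl fun y hy => ?_
  rw [filter_true_of_mem]
  · simp
  · intro x hx
    simp only [Fintype.mem_piFinset, mem_Icc] at hx
    exact append_mem_PF_of_le hy hx fun i j _ _ => Subsingleton.elim i j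

/-- The expected length of the final block of occupied spots is `m / (n - m + 1)`. -/
theorem sum_sub_slackSpot {m n : ℕ} (h : m ≤ n) :
    ∑ y ∈ PF m n, ((n : ℝ) - slackSpot n 0 y) = m / (n - m + 1) * #(PF m n) := by
  have h1 := card_PF (m := m) (n := n) (by omega)
  have h2 := card_PF (m := 1 + m) (n := n) (by omega)
  rw [sum_sub_distrib, ← card_PF_succ, sum_const, nsmul_eq_mul]
  have hn : (n : ℝ) + 1 ≠ 0 := by positivity
  have hm : (n : ℝ) - m + 1 ≠ 0 := by
    have : (m : ℝ) ≤ n := by exact_mod_cast h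
    linarith
  field_simp
  apply mul_left_cancel₀ hn
  push_cast at h2
  rw [pow_add, pow_one] at h2
  linear_combination ((n : ℝ) * (n - m + 1) - m) * h1 - (n - m + 1) * h2

/-! ### Lists of preferences with a pair of cars in special position -/

theorem card_filter_lt_and_lt {ι : Type*} [Fintype ι] [DecidableEq ι] {i j : ι} (hij : i ≠ j)
    (s n : ℕ) :
    #{x ∈ Fintype.piFinset fun _ : ι => Icc 1 n | s < x i ∧ s < x j} * n ^ 2
      ≤ (n - s) ^ 2 * n ^ Fintype.card ι := by
  have h : {x ∈ Fintype.piFinset fun _ : ι => Icc 1 n | s < x i ∧ s < x j} ⊆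
      Fintype.piFinset fun k => if k = i ∨ k = j then Ioc s n else Icc 1 n := by
    intro x hx
    simp only [mem_filter, Fintype.mem_piFinset, mem_Icc] at hx
    rw [Fintype.mem_piFinset]
    intro k
    have := hx.1 k
    split_ifs with hk
    · rcases hk with rfl | rfl <;> simp <;> omega
    · simpa using this
  refine (Nat.mul_le_mul_right _ (card_le_card h)).trans (le_of_eq ?_)
  have hj : j ∈ univ.erase i := by simp [hij.symm]
  have hc : ∀ f : ι → ℕ, ∏ k, f k = f i * (f j * ∏ k ∈ (univ.erase i).erase j, f k) := fun f => by
    rw [mul_prod_erase _ _ hj, mul_prod_erase _ _ (mem_univ i)]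
  have h2 : n ^ Fintype.card ι = n * (n * ∏ k ∈ ((univ : Finset ι).erase i).erase j, n) := by
    rw [← hc fun _ => n]; simp
  rw [h2, Fintype.card_piFinset, hc]
  have h3 : ∀ k ∈ ((univ : Finset ι).erase i).erase j,
      #(if k = i ∨ k = j then Ioc s n else Icc 1 n) = n := fun k hk => by
    simp only [mem_erase] at hk
    simp [hk.1, hk.2.1]
  rw [prod_congr rfl h3]
  simp
  ring

theorem card_filter_eq {ι : Type*} [Fintype ι] [DecidableEq ι] {i j : ι} (hij : i ≠ j) (n : ℕ) :
    #{x ∈ Fintype.piFinset fun _ : ι => Icc 1 n | x i = x j} * n ≤ n ^ Fintype.card ι := by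
  have h : #(({x ∈ Fintype.piFinset fun _ : ι => Icc 1 n | x i = x j}) ×ˢ Icc 1 n)
      ≤ #(Fintype.piFinset fun _ : ι => Icc 1 n) := by
    refine card_le_card_of_injOn (fun a => Function.update a.1 j a.2) ?_ ?_
    · intro a ha
      simp only [coe_product, Set.mem_prod, mem_coe, mem_filter, Fintype.mem_piFinset] at ha
      simp only [mem_coe, Fintype.mem_piFinset]
      intro k
      rcases eq_or_ne k j with rfl | hk
      · simpa using ha.2
      · simpa [hk] using ha.1.1 k
    · intro a ha b hb hab
      simp only [coe_product, Set.mem_prod, mem_coe, mem_filter] at ha hb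
      have hab' : ∀ k, Function.update a.1 j a.2 k = Function.update b.1 j b.2 k :=
        fun k => congrFun hab k
      refine Prod.ext (funext fun k => ?_) (by simpa using hab' j)
      rcases eq_or_ne k j with rfl | hk
      · rw [← ha.1.2, ← hb.1.2]
        simpa [hij] using hab' i
      · simpa [hk] using hab' k
  rw [card_product, Fintype.card_piFinset] at h
  simpa using h

/-! ### Second moment of the end region of the street -/

theorem PF_subset (m n : ℕ) : PF m n ⊆ Fintype.piFinset fun _ : Fin m => Icc 1 n := fun π hπ => by
  simpa using (mem_PF.1 hπ).1

theorem sum_piFinset_pow_card_lt (m : ℕ) {n t : ℕ} (ht : t ≤ n) (x : ℝ) :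
    ∑ y ∈ Fintype.piFinset (fun _ : Fin m => Icc 1 n), x ^ #{i | t < y i}
      = (t + (n - t) * x) ^ m := by
  have h : ∑ k ∈ Icc 1 n, (if t < k then x else 1) = t + (n - t) * x := by
    rw [sum_ite, sum_const, sum_const]
    have h1 : {k ∈ Icc 1 n | t < k} = Ioc t n := by ext; simp; omega
    have h2 : {k ∈ Icc 1 n | ¬ t < k} = Icc 1 t := by ext; simp; omega
    rw [h1, h2]
    simp [Nat.cast_sub ht]
    ring
  rw [← h, sum_pow']
  refine sum_congr rfl fun y _ => ?_
  rw [prod_ite]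
  simp

/-- Exponential Markov bound: under the uniform distribution on all lists of preferences, the
number of preferences beyond `t` is binomial with mean at most `c (n - t)`; it exceeds
`n - t - r` with probability at most a constant times `(c * exp (1 - c)) ^ (n - t)`. -/
theorem sum_sq_slackSpot_le {c : ℝ} (hc0 : 0 < c) (hc1 : c < 1) (r : ℕ) :
    ∃ C : ℝ, ∀ m n : ℕ, 1 ≤ n → (m : ℝ) ≤ c * n →
      ∑ y ∈ PF m n, (1 + ((n : ℝ) - slackSpot n r y)) ^ 2 ≤ C * #(PF m n) := by
  set q : ℝ := c * Real.exp (1 - c) with hq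
  have hq0 : 0 ≤ q := by positivity
  have hq1 : q < 1 := by
    have h : Real.log c + (1 - c) < 0 := by
      have := Real.log_lt_sub_one_of_pos hc0 hc1.ne
      linarith
    have h' := Real.exp_lt_exp.2 h
    rwa [Real.exp_add, Real.exp_log hc0, Real.exp_zero] at h'
  have hsum : Summable fun k : ℕ => (1 + (k : ℝ)) ^ 2 * q ^ k := by
    have h (j : ℕ) := summable_pow_mul_geometric_of_norm_lt_one (R := ℝ) j
      (r := q) (by rwa [Real.norm_of_nonneg hq0])
    refine ((h 2).add (((h 1).mul_left 2).add (h 0))).congr fun k => ?_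
    ring
  set S : ℝ := ∑' k : ℕ, (1 + (k : ℝ)) ^ 2 * q ^ k
  have hS0 : 0 ≤ S := tsum_nonneg fun k => by positivity
  refine ⟨c⁻¹ ^ r * S / (1 - c), fun m n hn hm => ?_⟩
  have hn0 : (0 : ℝ) < n := by exact_mod_cast hn
  let w : ℕ → (Fin m → ℕ) → ℝ := fun k y =>
    (1 + (k : ℝ)) ^ 2 * (c ^ k * c⁻¹ ^ r * c⁻¹ ^ #{i | n - k < y i})
  have hw : ∀ k y, 0 ≤ w k y := fun k y => by positivity
  have h1 : ∀ y : Fin m → ℕ, (1 + ((n : ℝ) - slackSpot n r y)) ^ 2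
      ≤ ∑ k ∈ range (n + 1), w k y := fun y => by
    have hs := slackSpot_le n r y
    refine le_trans ?_ (single_le_sum (f := fun k => w k y) (fun k _ => hw k y)
      (a := n - slackSpot n r y) (mem_range.2 (by omega)))
    have hl := le_of_slackSpot n r y
    simp only [w, Nat.cast_sub hs, Nat.sub_sub_self hs]
    refine le_mul_of_one_le_right (sq_nonneg _) ?_
    set N := #{i | slackSpot n r y < y i}
    have hc : 1 ≤ c⁻¹ := (one_le_inv₀ hc0).2 hc1.le
    calc (1 : ℝ) = c ^ (n - slackSpot n r y) * c⁻¹ ^ (n - slackSpot n r y) := by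
          rw [← mul_pow, mul_inv_cancel₀ hc0.ne', one_pow]
      _ ≤ c ^ (n - slackSpot n r y) * c⁻¹ ^ (r + N) := by
          gcongr
          omega
      _ = _ := by rw [pow_add, mul_assoc]
  have h2 : ∀ k ∈ range (n + 1), ∑ y ∈ Fintype.piFinset (fun _ : Fin m => Icc 1 n), w k y
      ≤ n ^ m * c⁻¹ ^ r * ((1 + (k : ℝ)) ^ 2 * q ^ k) := fun k hk => by
    have hk : k ≤ n := by rw [mem_range] at hk; omega
    have h3 : (((n - k : ℕ) : ℝ) + (n - (n - k : ℕ)) * c⁻¹) ^ m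
        ≤ n ^ m * Real.exp (1 - c) ^ k := by
      have e : ((n - k : ℕ) : ℝ) + (n - (n - k : ℕ)) * c⁻¹
          = n * (1 + k / n * (c⁻¹ - 1)) := by
        rw [Nat.cast_sub hk]; field_simp; ring
      have hx : 0 ≤ (k : ℝ) / n * (c⁻¹ - 1) := by
        have : 1 ≤ c⁻¹ := (one_le_inv₀ hc0).2 hc1.le
        exact mul_nonneg (by positivity) (by linarith)
      rw [e, mul_pow, ← Real.exp_nat_mul]
      refine mul_le_mul_of_nonneg_left ?_ (by positivity)
      calc (1 + (k : ℝ) / n * (c⁻¹ - 1)) ^ m ≤ Real.exp (k / n * (c⁻¹ - 1)) ^ m := by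
            refine pow_le_pow_left₀ (by linarith) ?_ m
            linarith [Real.add_one_le_exp ((k : ℝ) / n * (c⁻¹ - 1))]
        _ = Real.exp (m * (k / n * (c⁻¹ - 1))) := by rw [← Real.exp_nat_mul]
        _ ≤ Real.exp (k * (1 - c)) := by
            refine Real.exp_le_exp.2 ((mul_le_mul_of_nonneg_right hm hx).trans (le_of_eq ?_))
            field_simp
    simp only [w, ← mul_sum]
    rw [sum_piFinset_pow_card_lt m (Nat.sub_le n k)]
    calc _ ≤ (1 + (k : ℝ)) ^ 2 * (c ^ k * c⁻¹ ^ r * (n ^ m * Real.exp (1 - c) ^ k)) := by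
          gcongr
      _ = _ := by rw [hq, mul_pow]; ring
  have hM := le_card_PF hc0 hc1 hm
  have h1c : 0 < 1 - c := by linarith
  calc ∑ y ∈ PF m n, (1 + ((n : ℝ) - slackSpot n r y)) ^ 2
      ≤ ∑ y ∈ PF m n, ∑ k ∈ range (n + 1), w k y := sum_le_sum fun y _ => h1 y
    _ ≤ ∑ y ∈ Fintype.piFinset (fun _ : Fin m => Icc 1 n), ∑ k ∈ range (n + 1), w k y := by
        refine sum_le_sum_of_subset_of_nonneg (PF_subset m n) fun y _ _ => ?_
        exact sum_nonneg fun k _ => hw k y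
    _ = ∑ k ∈ range (n + 1), ∑ y ∈ Fintype.piFinset (fun _ : Fin m => Icc 1 n), w k y := sum_comm
    _ ≤ ∑ k ∈ range (n + 1), n ^ m * c⁻¹ ^ r * ((1 + (k : ℝ)) ^ 2 * q ^ k) := sum_le_sum h2
    _ ≤ n ^ m * c⁻¹ ^ r * S := by
        rw [← mul_sum]
        refine mul_le_mul_of_nonneg_left ?_ (by positivity)
        exact hsum.sum_le_tsum _ fun k _ => by positivity
    _ = c⁻¹ ^ r * S / (1 - c) * ((1 - c) * n ^ m) := by field_simp
    _ ≤ _ := by gcongr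

/-! ### Power sums and products of first-order expansions -/

/-- The coefficient of `s ^ p` in `(p + 1) * ∑ j ∈ Icc 1 s, j ^ p`; the case `p = 0` is
exceptional, as there is no second term then. -/
noncomputable def powerSumCoeff (p : ℕ) : ℝ := if p = 0 then 0 else ((p : ℝ) + 1) / 2

theorem powerSumCoeff_nonneg (p : ℕ) : 0 ≤ powerSumCoeff p := by
  unfold powerSumCoeff; split_ifs <;> positivity

theorem abs_sum_pow_sub_le (p : ℕ) : ∃ K : ℝ, 0 ≤ K ∧ ∀ s n : ℕ, s ≤ n → 1 ≤ n →
    |((p : ℝ) + 1) * ∑ j ∈ Icc 1 s, (j : ℝ) ^ p - s ^ (p + 1) - powerSumCoeff p * s ^ p|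
      ≤ K * ((n : ℝ) ^ (p + 1) / n ^ 2) := by
  rcases p with _ | p
  · exact ⟨0, le_rfl, fun s n _ _ => by simp [powerSumCoeff]⟩
  refine ⟨∑ i ∈ range p, |(bernoulli' (i + 2) : ℝ) * (p + 2).choose (i + 2)|,
    sum_nonneg fun _ _ => abs_nonneg _, fun s n hs hn => ?_⟩
  have hn0 : (1 : ℝ) ≤ n := by exact_mod_cast hn
  have hsn : (s : ℝ) ≤ n := by exact_mod_cast hs
  have h := congrArg (fun q : ℚ => (q : ℝ)) (sum_Ico_pow s (p + 1))
  have hI : Ico 1 (s + 1) = Icc 1 s := by ext; simp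
  rw [hI] at h
  push_cast at h
  rw [← sum_div] at h
  have hp : ((p : ℝ) + 1 + 1) ≠ 0 := by positivity
  have e : (((p + 1 : ℕ) : ℝ) + 1) * ∑ j ∈ Icc 1 s, (j : ℝ) ^ (p + 1) - s ^ (p + 1 + 1)
      - powerSumCoeff (p + 1) * s ^ (p + 1)
      = ∑ i ∈ range p, (bernoulli' (i + 2) : ℝ) * (p + 2).choose (i + 2) * (s : ℝ) ^ (p - i) := by
    push_cast
    rw [h, mul_div_cancel₀ _ hp, sum_range_succ', sum_range_succ']
    simp only [powerSumCoeff, bernoulli'_zero]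
    have h1 : ∀ i, p + 1 + 1 - (i + 1 + 1) = p - i := fun i => by omega
    have h2 : p + 1 + 1 - (0 + 1) = p + 1 := by omega
    simp only [h1, h2]
    push_cast
    simp
    ring
  rw [e]
  have e2 : (n : ℝ) ^ (p + 1 + 1) / n ^ 2 = n ^ p := by
    rw [div_eq_iff (by positivity)]; ring
  rw [e2, sum_mul]
  refine (abs_sum_le_sum_abs _ _).trans (sum_le_sum fun i _ => ?_)
  rw [abs_mul]
  refine mul_le_mul_of_nonneg_left ?_ (abs_nonneg _)
  rw [abs_of_nonneg (by positivity)]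
  calc (s : ℝ) ^ (p - i) ≤ (n : ℝ) ^ (p - i) := by gcongr
    _ ≤ _ := pow_le_pow_right₀ hn0 (Nat.sub_le _ _)

theorem abs_one_sub_pow_sub_le {u : ℝ} (h0 : 0 ≤ u) (h1 : u ≤ 1) (q : ℕ) :
    |(1 - u) ^ q - (1 - q * u)| ≤ (q : ℝ) ^ 2 * u ^ 2 := by
  have hl : 1 - q * u ≤ (1 - u) ^ q := by
    have := one_add_mul_le_pow (a := -u) (by linarith) q
    have e : 1 + -u = 1 - u := by ring
    rw [e] at this
    linarith
  have hu : (1 - u) ^ q ≤ 1 - q * u + (q : ℝ) ^ 2 * u ^ 2 := by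
    clear hl
    induction q with
    | zero => simp
    | succ q ih =>
      rw [pow_succ]
      have := mul_le_mul_of_nonneg_right ih (sub_nonneg.2 h1)
      have h3 : 0 ≤ (q : ℝ) ^ 2 * u ^ 3 := by positivity
      have h4 : 0 ≤ (q : ℝ) * u ^ 2 := by positivity
      have h5 : 0 ≤ u ^ 2 := by positivity
      push_cast
      nlinarith
  rw [abs_le]
  constructor <;> nlinarith [sq_nonneg (q * u)]

theorem abs_normalized_sum_pow_sub_le (p : ℕ) : ∃ K : ℝ, 0 ≤ K ∧ ∀ s n : ℕ, s ≤ n → 1 ≤ n →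
    |((p : ℝ) + 1) / (n : ℝ) ^ (p + 1) * ∑ j ∈ Icc 1 s, (j : ℝ) ^ p
        - (1 + (powerSumCoeff p - (p + 1) * (n - s)) / n)|
      ≤ K * ((1 + ((n : ℝ) - s)) / n) ^ 2 := by
  obtain ⟨K, hK0, hK⟩ := abs_sum_pow_sub_le p
  refine ⟨K + ((p : ℝ) + 1) ^ 2 + powerSumCoeff p * p,
    by have := powerSumCoeff_nonneg p; positivity, fun s n hs hn => ?_⟩
  have hn0 : (0 : ℝ) < n := by exact_mod_cast hn
  have hsn : (s : ℝ) ≤ n := by exact_mod_cast hs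
  set u : ℝ := (n - s) / n with hu
  have hu0 : 0 ≤ u := div_nonneg (by linarith) hn0.le
  have hu1 : u ≤ 1 := by rw [hu, div_le_one hn0]; linarith [s.cast_nonneg (α := ℝ)]
  have hsu : (s : ℝ) = n * (1 - u) := by rw [hu]; field_simp; ring
  set δ : ℝ := (1 + ((n : ℝ) - s)) / n with hδ
  have hδe : δ = 1 / n + u := by rw [hδ, hu]; field_simp
  have hn1 : 0 < 1 / (n : ℝ) := by positivity
  have b1 : |((p : ℝ) + 1) / (n : ℝ) ^ (p + 1) * ∑ j ∈ Icc 1 s, (j : ℝ) ^ p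
      - (1 - u) ^ (p + 1) - powerSumCoeff p * (1 / n) * (1 - u) ^ p| ≤ K * δ ^ 2 := by
    have h := hK s n hs hn
    have e : ((p : ℝ) + 1) / (n : ℝ) ^ (p + 1) * ∑ j ∈ Icc 1 s, (j : ℝ) ^ p
        - (1 - u) ^ (p + 1) - powerSumCoeff p * (1 / n) * (1 - u) ^ p
        = (((p : ℝ) + 1) * ∑ j ∈ Icc 1 s, (j : ℝ) ^ p - s ^ (p + 1) - powerSumCoeff p * s ^ p)
          / (n : ℝ) ^ (p + 1) := by
      rw [hsu, mul_pow, mul_pow, pow_succ (n : ℝ) p]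
      field_simp
    rw [e, abs_div, abs_of_pos (pow_pos hn0 (p + 1)), div_le_iff₀ (pow_pos hn0 _)]
    refine h.trans ?_
    have : (n : ℝ) ^ (p + 1) / n ^ 2 = (1 / (n : ℝ)) ^ 2 * (n : ℝ) ^ (p + 1) := by
      field_simp
    rw [this, mul_assoc]
    have h2 : 1 / (n : ℝ) ≤ δ := by linarith
    gcongr
  have b2 := abs_one_sub_pow_sub_le hu0 hu1 (p + 1)
  have b3 : |(1 - u) ^ p - 1| ≤ p * u := by
    have hl := one_add_mul_le_pow (a := -u) (by linarith) p
    have e : 1 + -u = 1 - u := by ring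
    rw [e] at hl
    have := pow_le_one₀ (n := p) (sub_nonneg.2 hu1) (by linarith)
    rw [abs_le]
    constructor <;> nlinarith [mul_nonneg (p.cast_nonneg (α := ℝ)) hu0]
  have hc := powerSumCoeff_nonneg p
  have b4 : |powerSumCoeff p * (1 / n) * ((1 - u) ^ p - 1)| ≤ powerSumCoeff p * p * δ ^ 2 := by
    rw [abs_mul, abs_of_nonneg (by positivity)]
    calc powerSumCoeff p * (1 / n) * |(1 - u) ^ p - 1|
        ≤ powerSumCoeff p * (1 / n) * (p * u) := by gcongr
      _ = powerSumCoeff p * p * ((1 / n) * u) := by ring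
      _ ≤ _ := by gcongr; rw [hδe]; nlinarith [mul_nonneg hn1.le hu0]
  have b5 : (((p + 1 : ℕ) : ℝ)) ^ 2 * u ^ 2 ≤ ((p : ℝ) + 1) ^ 2 * δ ^ 2 := by
    push_cast
    have : u ≤ δ := by linarith
    gcongr
  have e : ((p : ℝ) + 1) / (n : ℝ) ^ (p + 1) * ∑ j ∈ Icc 1 s, (j : ℝ) ^ p
        - (1 + (powerSumCoeff p - (p + 1) * (n - s)) / n)
      = (((p : ℝ) + 1) / (n : ℝ) ^ (p + 1) * ∑ j ∈ Icc 1 s, (j : ℝ) ^ p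
        - (1 - u) ^ (p + 1) - powerSumCoeff p * (1 / n) * (1 - u) ^ p)
        + ((1 - u) ^ (p + 1) - (1 - ((p + 1 : ℕ) : ℝ) * u))
        + powerSumCoeff p * (1 / n) * ((1 - u) ^ p - 1) := by
    rw [hu]; push_cast; field_simp; ring
  rw [e]
  refine (abs_add_three _ _ _).trans ?_
  linarith

/-- First-order expansion of a product of factors `1 + α i + O(δ ^ 2)` with `α i = O(δ)`. -/
theorem abs_prod_sub_le {ι : Type*} [DecidableEq ι] (s : Finset ι) {K D : ℝ} (hK : 0 ≤ K)
    (hD : 0 ≤ D) : ∃ K' : ℝ, 0 ≤ K' ∧ ∀ (a α : ι → ℝ) (δ : ℝ), 0 ≤ δ → δ ≤ D →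
      (∀ i ∈ s, |α i| ≤ K * δ) → (∀ i ∈ s, |a i - (1 + α i)| ≤ K * δ ^ 2) →
      |∏ i ∈ s, a i - (1 + ∑ i ∈ s, α i)| ≤ K' * δ ^ 2 := by
  induction s using Finset.induction_on with
  | empty => exact ⟨0, le_rfl, fun a α δ _ _ _ _ => by simp⟩
  | insert j s hj ih =>
    obtain ⟨K', hK'0, hK'⟩ := ih
    obtain ⟨k, hk⟩ : ∃ k : ℝ, (#s : ℝ) = k := ⟨_, rfl⟩
    have hk0 : 0 ≤ k := hk ▸ (#s).cast_nonneg
    refine ⟨K * (1 + k * K * D + K' * D ^ 2) + (K' + k * K * K + K * D * K'), by positivity,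
      fun a α δ h0 h1 hα ha => ?_⟩
    rw [prod_insert hj, sum_insert hj]
    have hP := hK' a α δ h0 h1 (fun i hi => hα i (mem_insert_of_mem hi))
      fun i hi => ha i (mem_insert_of_mem hi)
    have hA : |∑ i ∈ s, α i| ≤ k * K * δ := by
      refine (abs_sum_le_sum_abs _ _).trans ?_
      refine (sum_le_sum fun i hi => hα i (mem_insert_of_mem hi)).trans (le_of_eq ?_)
      rw [sum_const, nsmul_eq_mul, hk]; ring
    have hαj := hα j (mem_insert_self _ _)
    have haj := ha j (mem_insert_self _ _)
    set P := ∏ i ∈ s, a i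
    set A := ∑ i ∈ s, α i
    have hPb : |P| ≤ 1 + k * K * D + K' * D ^ 2 := by
      have e : P = (P - (1 + A)) + 1 + A := by ring
      rw [e]
      refine (abs_add_three _ _ _).trans ?_
      have t1 : K' * δ ^ 2 ≤ K' * D ^ 2 :=
        mul_le_mul_of_nonneg_left (pow_le_pow_left₀ h0 h1 2) hK'0
      have t2 : k * K * δ ≤ k * K * D := mul_le_mul_of_nonneg_left h1 (by positivity)
      rw [abs_one]
      linarith
    have e : a j * P - (1 + (α j + A))
        = (a j - (1 + α j)) * P + ((P - (1 + A)) + (α j * A + α j * (P - (1 + A)))) := by ring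
    rw [e]
    have t1 : |(a j - (1 + α j)) * P| ≤ K * δ ^ 2 * (1 + k * K * D + K' * D ^ 2) := by
      rw [abs_mul]; gcongr
    have t2 : |α j * A| ≤ K * δ * (k * K * δ) := by rw [abs_mul]; gcongr
    have t3 : |α j * (P - (1 + A))| ≤ K * D * (K' * δ ^ 2) := by
      rw [abs_mul]
      have : K * δ ≤ K * D := by gcongr
      gcongr
      linarith
    have t4 := abs_add_le ((a j - (1 + α j)) * P)
      ((P - (1 + A)) + (α j * A + α j * (P - (1 + A))))
    have t5 := abs_add_three (P - (1 + A)) (α j * A) (α j * (P - (1 + A)))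
    rw [add_assoc] at t5
    linarith

/-! ### Moments of the preferences -/

/-- For a fixed parking function `y` of the other cars, the normalized sum of a monomial in the
preferences of `l` additional cars is, up to second order, the one over the box
`{1, …, s} ^ l`, where `s` is the last free spot. -/
theorem abs_sum_append_sub_le {l : ℕ} (p : Fin l → ℕ) : ∃ K : ℝ, 0 ≤ K ∧ ∀ m n : ℕ, 1 ≤ n →
    ∀ y ∈ PF m n,
      |(∏ i, ((p i : ℝ) + 1)) / (n : ℝ) ^ (∑ i, p i + l) *
          (∑ x ∈ Fintype.piFinset (fun _ : Fin l => Icc 1 (slackSpot n 0 y)) with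
            Fin.append x y ∈ PF (l + m) n, ∏ i, (x i : ℝ) ^ p i)
        - (1 + (∑ i, powerSumCoeff (p i) - (∑ i, ((p i : ℝ) + 1)) * (n - slackSpot n 0 y)) / n)|
      ≤ K * ((1 + ((n : ℝ) - slackSpot n l y)) / n) ^ 2 := by
  choose κ hκ0 hκ using fun i => abs_normalized_sum_pow_sub_le (p i)
  have hcoef := fun i => powerSumCoeff_nonneg (p i)
  set K₁ : ℝ := ∑ i, (κ i + powerSumCoeff (p i) + (p i + 1)) with hK₁
  have hterm : ∀ i, 0 ≤ κ i + powerSumCoeff (p i) + (p i + 1) := fun i => by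
    have := hκ0 i; have := hcoef i; positivity
  have hle : ∀ i, κ i + powerSumCoeff (p i) + (p i + 1) ≤ K₁ := fun i =>
    single_le_sum (f := fun i => κ i + powerSumCoeff (p i) + ((p i : ℝ) + 1))
      (fun i _ => hterm i) (mem_univ i)
  have hK₁0 : 0 ≤ K₁ := sum_nonneg fun i _ => hterm i
  obtain ⟨K₂, hK₂0, hK₂⟩ := abs_prod_sub_le (univ : Finset (Fin l)) hK₁0 (zero_le_two (α := ℝ))
  set W : ℝ := ∏ i, ((p i : ℝ) + 1) with hW
  have hW0 : 0 ≤ W := prod_nonneg fun i _ => by positivity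
  refine ⟨K₂ + W * l ^ 2, by positivity, fun m n hn y hy => ?_⟩
  have hn0 : (0 : ℝ) < n := by exact_mod_cast hn
  set s := slackSpot n 0 y
  set t := slackSpot n l y
  have hsn : (s : ℝ) ≤ n := by exact_mod_cast slackSpot_le n 0 y
  have hts : (t : ℝ) ≤ s := by exact_mod_cast slackSpot_le_slackSpot_zero n l y
  have hs1 : (0 : ℝ) ≤ s := s.cast_nonneg
  have hn1 : (1 : ℝ) ≤ n := by exact_mod_cast hn
  set δ : ℝ := (1 + ((n : ℝ) - s)) / n with hδ
  have hδ0 : 0 ≤ δ := div_nonneg (by linarith) hn0.le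
  have hδ2 : δ ≤ 2 := by rw [hδ, div_le_iff₀ hn0]; linarith
  have hδt : δ ≤ (1 + ((n : ℝ) - t)) / n := by rw [hδ]; gcongr
  -- the sum over the whole box
  have hbox := hK₂ (fun i => ((p i : ℝ) + 1) / (n : ℝ) ^ (p i + 1) * ∑ j ∈ Icc 1 s, (j : ℝ) ^ p i)
    (fun i => (powerSumCoeff (p i) - ((p i : ℝ) + 1) * (n - s)) / n) δ hδ0 hδ2
    (fun i _ => by
      rw [abs_div, abs_of_pos hn0, hδ, mul_div_assoc']
      gcongr
      have h1 := hle i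
      have h2 := hcoef i
      have h3 := hκ0 i
      have h4 : 0 ≤ ((p i : ℝ) + 1) * (n - s) := mul_nonneg (by positivity) (by linarith)
      have h5 : ((p i : ℝ) + 1) * (n - s) ≤ K₁ * (n - s) :=
        mul_le_mul_of_nonneg_right (by linarith) (by linarith)
      have h6 : (0 : ℝ) ≤ p i := (p i).cast_nonneg
      rw [abs_le]
      constructor <;> nlinarith)
    (fun i _ => (hκ i s n (slackSpot_le n 0 y) hn).trans (by
      have h1 := hle i
      have h2 := hcoef i
      have h6 : (0 : ℝ) ≤ p i := (p i).cast_nonneg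
      exact mul_le_mul_of_nonneg_right (by linarith) (sq_nonneg _)))
  have e1 : ∏ i, (((p i : ℝ) + 1) / (n : ℝ) ^ (p i + 1) * ∑ j ∈ Icc 1 s, (j : ℝ) ^ p i)
      = W / (n : ℝ) ^ (∑ i, p i + l) *
        ∑ x ∈ Fintype.piFinset (fun _ : Fin l => Icc 1 s), ∏ i, (x i : ℝ) ^ p i := by
    rw [prod_mul_distrib, prod_div_distrib, prod_pow_eq_pow_sum, prod_univ_sum, sum_add_distrib]
    simp [hW]
  have e2 : ∑ i, (powerSumCoeff (p i) - ((p i : ℝ) + 1) * (n - s)) / n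
      = (∑ i, powerSumCoeff (p i) - (∑ i, ((p i : ℝ) + 1)) * (n - s)) / n := by
    rw [← sum_div, sum_sub_distrib, sum_mul]
  rw [e1, e2] at hbox
  -- the part of the box where not all cars park
  have hsplit := sum_filter_add_sum_filter_not
    (Fintype.piFinset (fun _ : Fin l => Icc 1 s)) (fun x => Fin.append x y ∈ PF (l + m) n)
    (fun x => ∏ i, (x i : ℝ) ^ p i)
  set bad := {x ∈ Fintype.piFinset (fun _ : Fin l => Icc 1 s) | ¬ Fin.append x y ∈ PF (l + m) n}
    with hbad
  have hbadsub : bad ⊆ (univ.filter fun ij : Fin l × Fin l => ij.1 ≠ ij.2).biUnion fun ij =>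
      {x ∈ Fintype.piFinset fun _ : Fin l => Icc 1 n | t < x ij.1 ∧ t < x ij.2} := by
    intro x hx
    simp only [hbad, mem_filter, Fintype.mem_piFinset, mem_Icc] at hx
    have h : ¬ ∀ i j, t < x i → t < x j → i = j := fun h =>
      hx.2 (append_mem_PF_of_le hy hx.1 h)
    push Not at h
    obtain ⟨i, j, hi, hj, hij⟩ := h
    simp only [mem_biUnion, mem_filter, mem_univ, true_and, Fintype.mem_piFinset, mem_Icc]
    exact ⟨(i, j), hij, fun k => ⟨(hx.1 k).1, (hx.1 k).2.trans (slackSpot_le n 0 y)⟩, hi, hj⟩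
  have hbadcard : (#bad : ℝ) * n ^ 2 ≤ l ^ 2 * ((n - t) ^ 2 * n ^ l) := by
    have h : #bad * n ^ 2 ≤ l ^ 2 * ((n - t) ^ 2 * n ^ l) := by
      refine (Nat.mul_le_mul_right _ ((card_le_card hbadsub).trans card_biUnion_le)).trans ?_
      rw [sum_mul]
      refine (sum_le_card_nsmul _ _ ((n - t) ^ 2 * n ^ l) fun ij hij => ?_).trans ?_
      · simpa using card_filter_lt_and_lt (mem_filter.1 hij).2 t n
      · rw [smul_eq_mul]
        refine Nat.mul_le_mul_right _ ((card_le_univ _).trans (le_of_eq ?_))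
        simp [sq]
    have h' : ((#bad * n ^ 2 : ℕ) : ℝ) ≤ ((l ^ 2 * ((n - t) ^ 2 * n ^ l) : ℕ) : ℝ) := by
      exact_mod_cast h
    rw [Nat.cast_mul, Nat.cast_mul, Nat.cast_mul, Nat.cast_pow, Nat.cast_pow, Nat.cast_pow,
      Nat.cast_pow, Nat.cast_sub (slackSpot_le n l y)] at h'
    exact h'
  have hbadsum0 : 0 ≤ ∑ x ∈ bad, ∏ i, (x i : ℝ) ^ p i :=
    sum_nonneg fun x _ => prod_nonneg fun i _ => by positivity
  have hbadsum : ∑ x ∈ bad, ∏ i, (x i : ℝ) ^ p i ≤ #bad * (n : ℝ) ^ (∑ i, p i) := by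
    rw [← nsmul_eq_mul]
    refine sum_le_card_nsmul _ _ _ fun x hx => ?_
    simp only [hbad, mem_filter, Fintype.mem_piFinset, mem_Icc] at hx
    rw [← prod_pow_eq_pow_sum]
    refine prod_le_prod (fun i _ => by positivity) fun i _ => ?_
    have : (x i : ℝ) ≤ n := by exact_mod_cast (hx.1 i).2.trans (slackSpot_le n 0 y)
    gcongr
  have hbadnorm : |W / (n : ℝ) ^ (∑ i, p i + l) * ∑ x ∈ bad, ∏ i, (x i : ℝ) ^ p i|
      ≤ W * l ^ 2 * ((1 + ((n : ℝ) - t)) / n) ^ 2 := by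
    rw [abs_of_nonneg (by positivity)]
    have h1 : (#bad : ℝ) ≤ l ^ 2 * ((n - t) ^ 2 * n ^ l) / n ^ 2 := by
      rw [le_div_iff₀ (by positivity)]; exact hbadcard
    calc _ ≤ W / (n : ℝ) ^ (∑ i, p i + l) * (l ^ 2 * ((n - t) ^ 2 * n ^ l) / n ^ 2
          * (n : ℝ) ^ (∑ i, p i)) := by gcongr; exact hbadsum.trans (by gcongr)
      _ = W * l ^ 2 * ((n - t) / n) ^ 2 := by rw [pow_add]; field_simp
      _ ≤ _ := by
        have : (0 : ℝ) ≤ n - t := by linarith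
        gcongr
        linarith
  rw [← hsplit, mul_add] at hbox
  set G := W / (n : ℝ) ^ (∑ i, p i + l) *
    ∑ x ∈ Fintype.piFinset (fun _ : Fin l => Icc 1 s) with Fin.append x y ∈ PF (l + m) n,
      ∏ i, (x i : ℝ) ^ p i
  set R := W / (n : ℝ) ^ (∑ i, p i + l) * ∑ x ∈ bad, ∏ i, (x i : ℝ) ^ p i
  set Z := 1 + (∑ i, powerSumCoeff (p i) - (∑ i, ((p i : ℝ) + 1)) * (n - s)) / n
  have e3 : G - Z = (G + R - Z) - R := by ring
  rw [e3]
  refine (abs_sub _ _).trans ?_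
  have h2 : K₂ * δ ^ 2 ≤ K₂ * ((1 + ((n : ℝ) - t)) / n) ^ 2 := by gcongr
  linarith

/-- The previous expansion, summed over the parking functions of the other cars. -/
theorem abs_sum_PF_add_sub_le {c : ℝ} (hc0 : 0 < c) (hc1 : c < 1) {l : ℕ} (p : Fin l → ℕ) :
    ∃ K : ℝ, ∀ m n : ℕ, 1 ≤ n → (m : ℝ) ≤ c * n →
      |(∏ i, ((p i : ℝ) + 1)) / (n : ℝ) ^ (∑ i, p i + l) *
          (∑ π ∈ PF (l + m) n, ∏ i, (π (Fin.castAdd m i) : ℝ) ^ p i) / #(PF m n)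
        - (1 + (∑ i, powerSumCoeff (p i)
            - (∑ i, ((p i : ℝ) + 1)) * (m / (n - m + 1))) / n)|
      ≤ K / (n : ℝ) ^ 2 := by
  obtain ⟨K, hK0, hK⟩ := abs_sum_append_sub_le p
  obtain ⟨C, hC⟩ := sum_sq_slackSpot_le hc0 hc1 l
  refine ⟨K * C, fun m n hn hm => ?_⟩
  have hn0 : (0 : ℝ) < n := by exact_mod_cast hn
  have hmn : m ≤ n := by
    have : (m : ℝ) ≤ n := by nlinarith
    exact_mod_cast this
  have hM : (0 : ℝ) < #(PF m n) :=
    lt_of_lt_of_le (mul_pos (by linarith) (by positivity)) (le_card_PF hc0 hc1 hm)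
  set M : ℝ := ((#(PF m n) : ℕ) : ℝ) with hMdef
  set V : ℝ := (∏ i, ((p i : ℝ) + 1)) / (n : ℝ) ^ (∑ i, p i + l)
  rw [sum_PF_add]
  simp only [Fin.append_left]
  have e : 1 + (∑ i, powerSumCoeff (p i) - (∑ i, ((p i : ℝ) + 1)) * (m / (n - m + 1))) / n
      = (∑ y ∈ PF m n, (1 + (∑ i, powerSumCoeff (p i)
          - (∑ i, ((p i : ℝ) + 1)) * (n - slackSpot n 0 y)) / n)) / M := by
    generalize ∑ i, powerSumCoeff (p i) = S
    generalize ∑ i, ((p i : ℝ) + 1) = Q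
    rw [sum_add_distrib, ← sum_div, sum_sub_distrib, ← mul_sum, sum_sub_slackSpot hmn]
    simp only [sum_const, nsmul_eq_mul]
    rw [← hMdef]
    field_simp
  rw [e, mul_sum, ← sub_div, ← sum_sub_distrib, abs_div, abs_of_pos hM, div_le_iff₀ hM]
  refine (abs_sum_le_sum_abs _ _).trans ((sum_le_sum fun y hy => hK m n hn y hy).trans ?_)
  simp only [div_pow]
  rw [← mul_sum, ← sum_div]
  calc _ ≤ K * (C * M / n ^ 2) := by gcongr; exact hC m n hn hm
    _ = _ := by ring

theorem abs_div_sub_le {A B a b e k₁ k₂ : ℝ} (hA : |A - (1 + a)| ≤ k₁) (hB : |B - (1 + b)| ≤ k₂)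
    (h : 1 / 2 ≤ B) :
    |A / B - (1 + e)| ≤ 2 * (k₁ + |a - b - e - b * e| + k₂ * (1 + |e|)) := by
  have hB0 : 0 < B := by linarith
  have e1 : A / B - (1 + e) = ((A - (1 + a)) + (a - b - e - b * e) - (B - (1 + b)) * (1 + e)) / B := by
    field_simp
    ring
  rw [e1, abs_div, abs_of_pos hB0, div_le_iff₀ hB0]
  have h1 := abs_sub ((A - (1 + a)) + (a - b - e - b * e)) ((B - (1 + b)) * (1 + e))
  have h2 := abs_add_le (A - (1 + a)) (a - b - e - b * e)
  have h3 : |(B - (1 + b)) * (1 + e)| ≤ k₂ * (1 + |e|) := by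
    rw [abs_mul]
    have h4 := abs_add_le 1 e
    rw [abs_one] at h4
    exact mul_le_mul hB h4 (abs_nonneg _) ((abs_nonneg _).trans hB)
  have h5 : 0 ≤ k₁ + |a - b - e - b * e| + k₂ * (1 + |e|) := by
    have := abs_nonneg (A - (1 + a)); have := abs_nonneg (a - b - e - b * e)
    have := abs_nonneg ((B - (1 + b)) * (1 + e))
    linarith
  nlinarith

/-- Expansion of the mixed moments of the first `l` preferences. The exponents may be `0`. -/
theorem abs_expect_preference_sub_le {c : ℝ} (hc0 : 0 < c) (hc1 : c < 1) {l : ℕ}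
    (p : Fin l → ℕ) : ∃ (C : ℝ) (N : ℕ), ∀ m n : ℕ, N ≤ n → ((l + m : ℕ) : ℝ) = c * n →
      |(∏ i, ((p i : ℝ) + 1)) / (n : ℝ) ^ (∑ i, p i) *
          (𝔼 π ∈ PF (l + m) n, ∏ i, (π (Fin.castAdd m i) : ℝ) ^ p i)
        - (1 + (∑ i, powerSumCoeff (p i) - c * (∑ i, (p i : ℝ)) / (1 - c)) / n)|
      ≤ C / (n : ℝ) ^ 2 := by
  obtain ⟨K₁, h₁⟩ := abs_sum_PF_add_sub_le hc0 hc1 p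
  -- the exponents `0` give the number of parking functions, which normalizes the expectation
  obtain ⟨K₂, h₂⟩ := abs_sum_PF_add_sub_le hc0 hc1 (fun _ : Fin l => 0)
  have h1c : 0 < 1 - c := by linarith
  set γ : ℝ := c / (1 - c) with hγ
  have hγ0 : 0 < γ := by positivity
  set P : ℝ := ∑ i, (p i : ℝ) with hP
  have hP0 : 0 ≤ P := sum_nonneg fun i _ => (p i).cast_nonneg
  set S : ℝ := ∑ i, powerSumCoeff (p i)
  set e₁ : ℝ := S - P * γ with he₁
  refine ⟨2 * (K₁ + (P * ((l + 1) / (1 - c) ^ 2) + l * γ * |e₁|) + K₂ * (1 + |e₁|)),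
    ⌈2 * (l * γ + K₂)⌉₊ + 1, fun m n hN hm => ?_⟩
  have hn : 1 ≤ n := by omega
  have hn1 : (1 : ℝ) ≤ n := by exact_mod_cast hn
  have hn0 : (0 : ℝ) < n := by linarith
  have hNn : 2 * (l * γ + K₂) ≤ n := by
    refine (Nat.le_ceil _).trans ?_
    have : ⌈2 * (l * γ + K₂)⌉₊ ≤ n := by omega
    exact_mod_cast this
  push_cast at hm
  have hmc : (m : ℝ) ≤ c * n := by linarith [l.cast_nonneg (α := ℝ)]
  have hA := h₁ m n hn hmc
  have hB := h₂ m n hn hmc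
  have hK₂ : 0 ≤ K₂ := by
    by_contra! h
    exact absurd ((abs_nonneg _).trans hB) (not_le.2 (div_neg_of_neg_of_pos h (by positivity)))
  have hM : (0 : ℝ) < #(PF m n) :=
    lt_of_lt_of_le (mul_pos h1c (by positivity)) (le_card_PF hc0 hc1 hmc)
  set β : ℝ := (m : ℝ) / (n - m + 1) with hβ
  have hden : 0 < (n : ℝ) - m + 1 := by nlinarith
  have hβ0 : 0 ≤ β := by positivity
  have hβγ : β ≤ γ ∧ γ - β ≤ (l + 1) / (1 - c) ^ 2 / n := by
    have e : γ - β = (l + c) / ((1 - c) * (n - m + 1)) := by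
      have hm' : (m : ℝ) = c * n - l := by linarith
      have h1c' := h1c.ne'
      have hd := hden.ne'
      rw [hγ, hβ]
      field_simp
      rw [hm']
      ring
    constructor
    · have : 0 ≤ γ - β := by rw [e]; positivity
      linarith
    · rw [e, div_div]
      have : (1 - c) ^ 2 * n ≤ (1 - c) * (n - m + 1) := by nlinarith
      gcongr
  have hlγ : l * β ≤ l * γ := mul_le_mul_of_nonneg_left hβγ.1 l.cast_nonneg
  have eA : ∑ i, ((p i : ℝ) + 1) = P + l := by rw [sum_add_distrib]; simp [hP]
  rw [eA] at hA
  have eB : (1 + (∑ i : Fin l, powerSumCoeff 0 - (∑ i : Fin l, (((0 : ℕ) : ℝ) + 1)) * β) / n)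
      = 1 + -(l * β / n) := by
    simp [powerSumCoeff]; ring
  rw [eB] at hB
  set A := (∏ i, ((p i : ℝ) + 1)) / (n : ℝ) ^ (∑ i, p i + l) *
          (∑ π ∈ PF (l + m) n, ∏ i, (π (Fin.castAdd m i) : ℝ) ^ p i) / #(PF m n) with hAdef
  set B := (∏ i : Fin l, (((0 : ℕ) : ℝ) + 1)) / (n : ℝ) ^ (∑ i : Fin l, 0 + l) *
          (∑ π ∈ PF (l + m) n, ∏ i, (π (Fin.castAdd m i) : ℝ) ^ 0) / #(PF m n) with hBdef
  have hBe : B = #(PF (l + m) n) / (n : ℝ) ^ l / #(PF m n) := by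
    rw [hBdef]; simp; ring
  have hBhalf : 1 / 2 ≤ B := by
    have h3 : K₂ / (n : ℝ) ^ 2 ≤ K₂ / n := by
      gcongr
      nlinarith
    have h4 : l * β / n + K₂ / n ≤ 1 / 2 := by
      rw [← add_div, div_le_iff₀ hn0]
      linarith
    have := (abs_le.1 hB).1
    linarith
  have hcard : (#(PF (l + m) n) : ℝ) ≠ 0 := by
    intro h0
    rw [hBe, h0] at hBhalf
    norm_num at hBhalf
  have eAB : (∏ i, ((p i : ℝ) + 1)) / (n : ℝ) ^ (∑ i, p i) *
      (𝔼 π ∈ PF (l + m) n, ∏ i, (π (Fin.castAdd m i) : ℝ) ^ p i) = A / B := by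
    rw [expect_eq_sum_div_card, hBe, hAdef, pow_add]
    field_simp
  have hec : S - c * P / (1 - c) = e₁ := by rw [he₁, hγ]; ring
  rw [eAB, hec]
  refine (abs_div_sub_le (e := e₁ / n) hA hB hBhalf).trans ?_
  have h5 : |(S - (P + l) * β) / n - -(l * β / n) - e₁ / n - -(l * β / n) * (e₁ / n)|
      ≤ (P * ((l + 1) / (1 - c) ^ 2) + l * γ * |e₁|) / n ^ 2 := by
    have e : (S - (P + l) * β) / n - -(l * β / n) - e₁ / n - -(l * β / n) * (e₁ / n)
        = P * (γ - β) / n + l * β * e₁ / n ^ 2 := by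
      rw [he₁]; field_simp; ring
    rw [e, add_div]
    refine (abs_add_le _ _).trans (add_le_add ?_ ?_)
    · rw [abs_of_nonneg (div_nonneg (mul_nonneg hP0 (by linarith [hβγ.1])) hn0.le)]
      calc P * (γ - β) / n ≤ P * ((l + 1) / (1 - c) ^ 2 / n) / n := by
            gcongr; exact hβγ.2
        _ = _ := by field_simp
    · rw [abs_div, abs_mul, abs_of_nonneg (by positivity : 0 ≤ l * β),
        abs_of_pos (by positivity : (0 : ℝ) < (n : ℝ) ^ 2)]
      gcongr
  have h6 : |e₁ / n| ≤ |e₁| := by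
    rw [abs_div, abs_of_pos hn0]
    exact div_le_self (abs_nonneg _) hn1
  have h7 : K₂ / (n : ℝ) ^ 2 * (1 + |e₁ / n|) ≤ K₂ / (n : ℝ) ^ 2 * (1 + |e₁|) := by
    gcongr
  calc _ ≤ 2 * (K₁ / (n : ℝ) ^ 2 + (P * ((l + 1) / (1 - c) ^ 2) + l * γ * |e₁|) / n ^ 2
        + K₂ / (n : ℝ) ^ 2 * (1 + |e₁|)) := by linarith
    _ = _ := by ring

/-! ### Comparison of outcomes and preferences -/

theorem parkingOutcome_eq_of_injective {l m : ℕ} (π : Fin (l + m) → ℕ)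
    (h : Function.Injective fun i : Fin l => π (Fin.castAdd m i)) (i : Fin l) :
    parkingOutcome π (Fin.castAdd m i) = π (Fin.castAdd m i) := by
  induction i using WellFoundedLT.induction with
  | _ i ih =>
    refine le_antisymm ((parkingOutcome_isLeast π _).2 ⟨le_rfl, fun j hj hji => ?_⟩)
      (le_parkingOutcome π _)
    have hjl : j.val < l := lt_trans (Fin.lt_def.1 hj) i.isLt
    obtain ⟨j, rfl⟩ : ∃ j' : Fin l, Fin.castAdd m j' = j := ⟨⟨j.val, hjl⟩, rfl⟩
    have hlt : j < i := hj
    rw [ih _ hlt] at hji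
    exact hlt.ne (h hji)

theorem parkingOutcome_le_add {m : ℕ} (π : Fin m → ℕ) (i : Fin m) :
    parkingOutcome π i ≤ π i + i := by
  by_contra! h
  have hsub : Icc (π i) (π i + i) ⊆ image (parkingOutcome π) (Iio i) := fun s hs => by
    rw [mem_Icc] at hs
    obtain ⟨j, hj, hjs⟩ := exists_parkingOutcome_eq π i hs.1 (by omega)
    exact mem_image.2 ⟨j, mem_Iio.2 hj, hjs⟩
  have hc := (card_le_card hsub).trans card_image_le
  rw [Nat.card_Icc, Fin.card_Iio] at hc
  omega

theorem mul_pow_sub_pow_le {a b n d : ℝ} (hb : 0 ≤ b) (hba : b ≤ a) (han : a ≤ n)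
    (hd : a ≤ b + d) (p : ℕ) : n * (a ^ p - b ^ p) ≤ p * d * n ^ p := by
  induction p with
  | zero => simp
  | succ p ih =>
    have ha : 0 ≤ a := hb.trans hba
    have hd0 : 0 ≤ d := by linarith
    have hn : 0 ≤ n := ha.trans han
    have h1 : a * (n * (a ^ p - b ^ p)) ≤ n * (p * d * n ^ p) :=
      (mul_le_mul_of_nonneg_left ih ha).trans
        (mul_le_mul_of_nonneg_right han (by positivity))
    have h2 : n * (b ^ p * (a - b)) ≤ n * (n ^ p * d) := by
      have : b ≤ n := hba.trans han
      gcongr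
      linarith
    calc n * (a ^ (p + 1) - b ^ (p + 1)) = a * (n * (a ^ p - b ^ p)) + n * (b ^ p * (a - b)) := by
          ring
      _ ≤ n * (p * d * n ^ p) + n * (n ^ p * d) := add_le_add h1 h2
      _ = _ := by push_cast; ring

theorem mul_prod_pow_sub_prod_pow_le {ι : Type*} [DecidableEq ι] (s : Finset ι) {a b : ι → ℝ}
    {n d : ℝ} (p : ι → ℕ) (hb : ∀ i, 0 ≤ b i) (hba : ∀ i, b i ≤ a i) (han : ∀ i, a i ≤ n)
    (hd : ∀ i, a i ≤ b i + d) (hd0 : 0 ≤ d) (hn : 0 ≤ n) :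
    n * (∏ i ∈ s, a i ^ p i - ∏ i ∈ s, b i ^ p i)
      ≤ (∑ i ∈ s, (p i : ℝ)) * d * n ^ ∑ i ∈ s, p i := by
  induction s using Finset.induction_on with
  | empty => simp
  | insert j s hj ih =>
    rw [prod_insert hj, prod_insert hj, sum_insert hj, sum_insert hj]
    have ha : ∀ i, 0 ≤ a i := fun i => (hb i).trans (hba i)
    have h1 : ∏ i ∈ s, b i ^ p i ≤ n ^ ∑ i ∈ s, p i := by
      rw [← prod_pow_eq_pow_sum]
      refine prod_le_prod (fun i _ => pow_nonneg (hb i) _) fun i _ => ?_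
      exact pow_le_pow_left₀ (hb i) ((hba i).trans (han i)) _
    have h2 := mul_pow_sub_pow_le (hb j) (hba j) (han j) (hd j) (p j)
    have h3 : a j ^ p j ≤ n ^ p j := pow_le_pow_left₀ (ha j) (han j) _
    have h4 : 0 ≤ ∏ i ∈ s, b i ^ p i := prod_nonneg fun i _ => pow_nonneg (hb i) _
    set A := ∏ i ∈ s, a i ^ p i
    set B := ∏ i ∈ s, b i ^ p i
    have hP : 0 ≤ ∑ i ∈ s, (p i : ℝ) := sum_nonneg fun i _ => (p i).cast_nonneg
    calc n * (a j ^ p j * A - b j ^ p j * B)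
        = a j ^ p j * (n * (A - B)) + n * (a j ^ p j - b j ^ p j) * B := by ring
      _ ≤ a j ^ p j * ((∑ i ∈ s, (p i : ℝ)) * d * n ^ ∑ i ∈ s, p i)
          + p j * d * n ^ p j * B := by
        have := pow_nonneg (ha j) (p j)
        gcongr
      _ ≤ n ^ p j * ((∑ i ∈ s, (p i : ℝ)) * d * n ^ ∑ i ∈ s, p i)
          + p j * d * n ^ p j * n ^ ∑ i ∈ s, p i := by gcongr
      _ = _ := by rw [pow_add]; ring

/-- The mixed moments of outcomes and of preferences differ at second order only: they agree
unless two of the first `l` cars have the same preference, which has probability `O(1 / n)`, and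
even then each of these cars parks less than `l` spots away from its preference. -/
theorem abs_expect_outcome_sub_expect_preference_le {c : ℝ} (hc0 : 0 < c) (hc1 : c < 1) {l : ℕ}
    (p : Fin l → ℕ) : ∃ C : ℝ, ∀ m n : ℕ, 1 ≤ n → ((l + m : ℕ) : ℝ) = c * n →
      |(𝔼 π ∈ PF (l + m) n, ∏ i, (parkingOutcome π (Fin.castAdd m i) : ℝ) ^ p i)
        - 𝔼 π ∈ PF (l + m) n, ∏ i, (π (Fin.castAdd m i) : ℝ) ^ p i|
      ≤ C / (n : ℝ) ^ 2 * (n : ℝ) ^ ∑ i, p i := by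
  have h1c : 0 < 1 - c := by linarith
  refine ⟨(∑ i, (p i : ℝ)) * l * l ^ 2 / (1 - c), fun m n hn hm => ?_⟩
  have hn0 : (0 : ℝ) < n := by exact_mod_cast hn
  have hM := le_card_PF hc0 hc1 hm.le
  have hM0 : (0 : ℝ) < #(PF (l + m) n) := lt_of_lt_of_le (by positivity) hM
  set P : ℝ := ∑ i, (p i : ℝ)
  have hP0 : 0 ≤ P := sum_nonneg fun i _ => (p i).cast_nonneg
  let F : (Fin (l + m) → ℕ) → ℝ := fun π =>
    ∏ i, (parkingOutcome π (Fin.castAdd m i) : ℝ) ^ p i - ∏ i, (π (Fin.castAdd m i) : ℝ) ^ p i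
  set coll := (univ.filter fun ij : Fin l × Fin l => ij.1 ≠ ij.2).biUnion fun ij =>
      {x ∈ Fintype.piFinset fun _ : Fin (l + m) => Icc 1 n |
        x (Fin.castAdd m ij.1) = x (Fin.castAdd m ij.2)} with hcoll
  have hcard : (#coll : ℝ) * n ≤ l ^ 2 * (n : ℝ) ^ (l + m) := by
    have h : #coll * n ≤ l ^ 2 * n ^ (l + m) := by
      refine (Nat.mul_le_mul_right _ card_biUnion_le).trans ?_
      rw [sum_mul]
      refine (sum_le_card_nsmul _ _ (n ^ (l + m)) fun ij hij => ?_).trans ?_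
      · have hne : Fin.castAdd m ij.1 ≠ Fin.castAdd m ij.2 := fun h =>
          (mem_filter.1 hij).2 (Fin.castAdd_injective l m h)
        simpa using card_filter_eq hne n
      · rw [smul_eq_mul]
        refine Nat.mul_le_mul_right _ ((card_le_univ _).trans (le_of_eq ?_))
        simp [sq]
    exact_mod_cast h
  have hF0 : ∀ π ∈ PF (l + m) n, π ∉ coll → |F π| = 0 := fun π hπ hnot => by
    have hinj : Function.Injective fun i : Fin l => π (Fin.castAdd m i) := by
      intro i j hij
      by_contra hne
      refine hnot ?_
      simp only [hcoll, mem_biUnion, mem_filter, mem_univ, true_and]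
      exact ⟨(i, j), hne, PF_subset _ _ hπ, hij⟩
    have : F π = 0 := by
      simp only [F, parkingOutcome_eq_of_injective π hinj, sub_self]
    rw [this, abs_zero]
  have hF1 : ∀ π ∈ PF (l + m) n, |F π| ≤ P * l * (n : ℝ) ^ (∑ i, p i) / n := fun π hπ => by
    have hle : ∀ i, (π (Fin.castAdd m i) : ℝ) ≤ parkingOutcome π (Fin.castAdd m i) := fun i => by
      exact_mod_cast le_parkingOutcome π _
    have hF : 0 ≤ F π := by
      refine sub_nonneg.2 (prod_le_prod (fun i _ => by positivity) fun i _ => ?_)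
      exact pow_le_pow_left₀ (Nat.cast_nonneg _) (hle i) _
    rw [abs_of_nonneg hF, le_div_iff₀ hn0, mul_comm]
    refine mul_prod_pow_sub_prod_pow_le univ p (fun i => Nat.cast_nonneg _) hle (fun i => ?_)
      (fun i => ?_) (Nat.cast_nonneg l) hn0.le
    · exact_mod_cast (mem_PF.1 hπ).2 _
    · have h := parkingOutcome_le_add π (Fin.castAdd m i)
      have : parkingOutcome π (Fin.castAdd m i) ≤ π (Fin.castAdd m i) + l := by
        rw [Fin.val_castAdd] at h
        omega
      exact_mod_cast this
  have hsum : ∑ π ∈ PF (l + m) n, |F π| ≤ #coll * (P * l * (n : ℝ) ^ (∑ i, p i) / n) := by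
    classical
    rw [← sum_filter_add_sum_filter_not (PF (l + m) n) (· ∈ coll),
      sum_eq_zero (s := {π ∈ PF (l + m) n | π ∉ coll}) fun π hπ =>
        hF0 π (mem_filter.1 hπ).1 (mem_filter.1 hπ).2, add_zero]
    refine (sum_le_card_nsmul _ _ _ fun π hπ => hF1 π (mem_filter.1 hπ).1).trans ?_
    rw [nsmul_eq_mul]
    refine mul_le_mul_of_nonneg_right ?_ (by positivity)
    exact_mod_cast card_le_card fun π hπ => (mem_filter.1 hπ).2
  rw [expect_eq_sum_div_card, expect_eq_sum_div_card, ← sub_div, ← sum_sub_distrib, abs_div,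
    abs_of_pos hM0, div_le_iff₀ hM0]
  refine (abs_sum_le_sum_abs _ _).trans (hsum.trans ?_)
  calc (#coll : ℝ) * (P * l * (n : ℝ) ^ (∑ i, p i) / n)
      = (#coll * n) * (P * l * (n : ℝ) ^ (∑ i, p i) / n ^ 2) := by field_simp
    _ ≤ (l ^ 2 * (n : ℝ) ^ (l + m)) * (P * l * (n : ℝ) ^ (∑ i, p i) / n ^ 2) := by gcongr
    _ = P * l * l ^ 2 / (1 - c) / n ^ 2 * n ^ (∑ i, p i) * ((1 - c) * n ^ (l + m)) := by
      field_simp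
    _ ≤ _ := by gcongr

/-! ### Moments of the outcomes -/

/-- Expansion of the mixed moments of the first `l` outcomes. The exponents may be `0`. -/
theorem abs_expect_outcome_sub_le {c : ℝ} (hc0 : 0 < c) (hc1 : c < 1) {l : ℕ}
    (p : Fin l → ℕ) : ∃ (C : ℝ) (N : ℕ), ∀ m n : ℕ, N ≤ n → ((l + m : ℕ) : ℝ) = c * n →
      |(∏ i, ((p i : ℝ) + 1)) / (n : ℝ) ^ (∑ i, p i) *
          (𝔼 π ∈ PF (l + m) n, ∏ i, (parkingOutcome π (Fin.castAdd m i) : ℝ) ^ p i)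
        - (1 + (∑ i, powerSumCoeff (p i) - c * (∑ i, (p i : ℝ)) / (1 - c)) / n)|
      ≤ C / (n : ℝ) ^ 2 := by
  obtain ⟨C₁, N, h₁⟩ := abs_expect_preference_sub_le hc0 hc1 p
  obtain ⟨C₂, h₂⟩ := abs_expect_outcome_sub_expect_preference_le hc0 hc1 p
  refine ⟨C₁ + (∏ i, ((p i : ℝ) + 1)) * C₂, N + 1, fun m n hN hm => ?_⟩
  have hn0 : (0 : ℝ) < n := by exact_mod_cast (show 0 < n by omega)
  have h1 := h₁ m n (by omega) hm
  have h2 := h₂ m n (by omega) hm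
  set W : ℝ := ∏ i, ((p i : ℝ) + 1)
  have hW : 0 ≤ W := prod_nonneg fun i _ => by positivity
  set X := 𝔼 π ∈ PF (l + m) n, ∏ i, (parkingOutcome π (Fin.castAdd m i) : ℝ) ^ p i
  set Y := 𝔼 π ∈ PF (l + m) n, ∏ i, (π (Fin.castAdd m i) : ℝ) ^ p i
  set Z := 1 + (∑ i, powerSumCoeff (p i) - c * (∑ i, (p i : ℝ)) / (1 - c)) / n
  have h3 : |W / (n : ℝ) ^ (∑ i, p i) * (X - Y)| ≤ W * C₂ / (n : ℝ) ^ 2 := by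
    rw [abs_mul, abs_of_nonneg (by positivity)]
    calc _ ≤ W / (n : ℝ) ^ (∑ i, p i) * (C₂ / (n : ℝ) ^ 2 * (n : ℝ) ^ ∑ i, p i) := by gcongr
      _ = _ := by field_simp
  have e : W / (n : ℝ) ^ (∑ i, p i) * X - Z
      = (W / (n : ℝ) ^ (∑ i, p i) * Y - Z) + W / (n : ℝ) ^ (∑ i, p i) * (X - Y) := by ring
  rw [e, add_div]
  exact (abs_add_le _ _).trans (add_le_add h1 h3)

theorem exists_eq_mul_of_abs_sub_le {W V X z z' C : ℝ} (hW : W ≠ 0) (hV : V ≠ 0)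
    (h : |W / V * X - (1 + z)| ≤ C) (hz : z = z') :
    ∃ ε : ℝ, |ε| ≤ C ∧ X = V / W * (1 + z' + ε) :=
  ⟨_, h, by rw [← hz]; field_simp; ring⟩

theorem mainTheorem5 (c : ℝ) (hc0 : 0 < c) (hc1 : c < 1) :
    -- mixed moments of the first `l` coordinates of the parking outcome
    (∀ (l : ℕ) (_ : 1 ≤ l) (p : Fin l → ℕ) (_ : ∀ i, 1 ≤ p i),
      ∃ (C : ℝ) (N : ℕ), ∀ (m n : ℕ) (_ : N ≤ n) (_ : (m : ℝ) = c * n) (hlm : l ≤ m),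
        ∃ ε : ℝ, |ε| ≤ C / (n : ℝ) ^ 2 ∧
          (𝔼 π ∈ PF m n, ∏ i : Fin l, (parkingOutcome π (Fin.castLE hlm i) : ℝ) ^ p i) =
            (n : ℝ) ^ (∑ i, p i) / (∏ i, ((p i : ℝ) + 1)) *
              (1 + 1 / (n : ℝ) * (((∑ i, (p i : ℝ)) + l) / 2
                - c * (∑ i, (p i : ℝ)) / (1 - c)) + ε)) ∧
    -- moments of any fixed single coordinate of the outcome, and of the parking function itself
    (∀ (k p : ℕ) (_ : 1 ≤ p),
      ∃ (C : ℝ) (N : ℕ), ∀ (m n : ℕ) (_ : N ≤ n) (_ : (m : ℝ) = c * n) (hk : k < m),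
        (∃ ε : ℝ, |ε| ≤ C / (n : ℝ) ^ 2 ∧
          (𝔼 π ∈ PF m n, (parkingOutcome π ⟨k, hk⟩ : ℝ) ^ p) =
            (n : ℝ) ^ p / ((p : ℝ) + 1) *
              (1 + 1 / (n : ℝ) * (((p : ℝ) + 1) / 2 - c * p / (1 - c)) + ε)) ∧
        (∃ ε : ℝ, |ε| ≤ C / (n : ℝ) ^ 2 ∧
          (𝔼 π ∈ PF m n, (π ⟨k, hk⟩ : ℝ) ^ p) =
            (n : ℝ) ^ p / ((p : ℝ) + 1) *
              (1 + 1 / (n : ℝ) * (((p : ℝ) + 1) / 2 - c * p / (1 - c)) + ε))) := by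
  constructor
  · intro l _ p hp
    obtain ⟨C, N, h⟩ := abs_expect_outcome_sub_le hc0 hc1 p
    refine ⟨C, N + 1, fun m n hN hm hlm => ?_⟩
    obtain ⟨m, rfl⟩ := Nat.exists_eq_add_of_le hlm
    have hn0 : (n : ℝ) ≠ 0 := by exact_mod_cast (show n ≠ 0 by omega)
    refine exists_eq_mul_of_abs_sub_le (prod_ne_zero_iff.2 fun i _ => by positivity)
      (pow_ne_zero _ hn0) (h m n (by omega) hm) ?_
    have hS : ∑ i, powerSumCoeff (p i) = (∑ i, (p i : ℝ) + l) / 2 := by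
      have h1 : ∀ i ∈ univ, powerSumCoeff (p i) = ((p i : ℝ) + 1) / 2 := fun i _ => by
        have := hp i
        rw [powerSumCoeff, if_neg (by omega)]
      rw [sum_congr rfl h1, ← sum_div, sum_add_distrib]
      simp
    rw [hS]
    ring
  · intro k p hp
    -- a single coordinate is a mixed moment of the first `k + 1` ones with exponents `0, …, 0, p`
    obtain ⟨C₁, N₁, h₁⟩ := abs_expect_outcome_sub_le hc0 hc1 (Pi.single (Fin.last k) p)
    obtain ⟨C₂, N₂, h₂⟩ := abs_expect_preference_sub_le hc0 hc1 (Pi.single (Fin.last k) p)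
    have hprod : ∀ x : Fin (k + 1) → ℝ,
        ∏ i, x i ^ (Pi.single (Fin.last k) p : Fin (k + 1) → ℕ) i = x (Fin.last k) ^ p :=
      fun x => by
        rw [prod_eq_single (Fin.last k) (fun i _ hi => by simp [hi]) (by simp)]
        simp
    have hW : ∏ i, (((Pi.single (Fin.last k) p : Fin (k + 1) → ℕ) i : ℝ) + 1) = p + 1 := by
      rw [prod_eq_single (Fin.last k) (fun i _ hi => by simp [hi]) (by simp)]
      simp
    have hP : ∑ i, (Pi.single (Fin.last k) p : Fin (k + 1) → ℕ) i = p := by simp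
    have hP' : ∑ i, (((Pi.single (Fin.last k) p : Fin (k + 1) → ℕ) i : ℕ) : ℝ) = p := by
      rw [← Nat.cast_sum, hP]
    have hS : ∑ i, powerSumCoeff ((Pi.single (Fin.last k) p : Fin (k + 1) → ℕ) i)
        = ((p : ℝ) + 1) / 2 := by
      rw [sum_eq_single (Fin.last k) (fun i _ hi => by simp [hi, powerSumCoeff]) (by simp)]
      rw [Pi.single_eq_same, powerSumCoeff, if_neg (by omega)]
    simp only [hprod, hW, hP, hP', hS] at h₁ h₂
    refine ⟨max C₁ C₂, max N₁ N₂ + 1, fun m n hN hm hk => ?_⟩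
    obtain ⟨m, rfl⟩ := Nat.exists_eq_add_of_le (Nat.succ_le_of_lt hk)
    have hn0 : (n : ℝ) ≠ 0 := by exact_mod_cast (show n ≠ 0 by omega)
    have hp0 : (p : ℝ) + 1 ≠ 0 := by positivity
    have hz : (((p : ℝ) + 1) / 2 - c * p / (1 - c)) / n
        = 1 / (n : ℝ) * (((p : ℝ) + 1) / 2 - c * p / (1 - c)) := by ring
    constructor
    · refine exists_eq_mul_of_abs_sub_le hp0 (pow_ne_zero _ hn0) ((h₁ m n (by omega) hm).trans ?_) hz
      gcongr
      exact le_max_left _ _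
    · refine exists_eq_mul_of_abs_sub_le hp0 (pow_ne_zero _ hn0) ((h₂ m n (by omega) hm).trans ?_) hz
      gcongr
      exact le_max_right _ _
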